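/- **Conventions.** Semigroups have an identity, and subsemigroups contain it; $S^\bullet$ is the set of cancellative elements and $S^\times$ the group of units of a semigroup $S$. A *quotient semigroup* is a semigroup $Q$ with $Q^\bullet=Q^\times$. A subsemigroup $H\subset Q$ is an *order* if every $q\in Q$ can be written as $q=as^{-1}$ and as $q=t^{-1}b$ with $a,b\in H$ and $s,t\in H\cap Q^\bullet$. Orders $H,H'$ are *equivalent* if $aHb\subset H'$ and $cH'd\subset H$ for some $a,b,c,d\in Q^\bullet$; an order is *maximal* if it is maximal with respect to inclusion in its equivalence class. For $X\subset Q$ let $\mathcal O_l(X)=\{q: qX\subset X\}$, $\mathcal O_r(X)=\{q: Xq\subset X\}$, $X^{-1}=\{q: XqX\subset X\}$ and $X_v=(X^{-1})^{-1}$. A *fractional left $H$-ideal* is a set $I\subset Q$ with $HI\subset I$, $I\cap Q^\bullet\neq\emptyset$ and $Iq\subset H$ for some $q\in Q^\bullet$ (fractional right ideals are defined symmetrically); it is a *left $H$-ideal* if $I\subset H$, *divisorial* if $I=I_v$, and *principal* if $I=Hq$ for some $q\in Q^\bullet$. A (fractional) *$H$-ideal* is both a (fractional) left and a (fractional) right $H$-ideal.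 A *maximal* divisorial (left) $H$-ideal is one that is maximal among those different from $H$. A maximal order $H$ is *arithmetical* if it satisfies the ACC on divisorial left and on divisorial right $H$-ideals, every fractional left or right $H$-ideal contains a fractional (two-sided) $H$-ideal, and the lattices of divisorial fractional left $H$-ideals and of divisorial right $H$-ideals (with meet $I\cap J$ and join $(I\cup J)_v$) are modular. Let $H$ be an arithmetical maximal order in $Q$, and let $\alpha$ be the set of maximal orders equivalent to $H$. Let $\mathcal F_v(\alpha)$ be the groupoid of all divisorial fractional left or right $H'$-ideals with $H'\in\alpha$: the product $I\cdot_v J=(IJ)_v$ is defined if $\mathcal O_r(I)=\mathcal O_l(J)$, and the identities are the elements of $\alpha$. Its universal vertex group $\mathbb G$ consists of the conjugacy classes $\mathcal X=\{a^{-1}xa\}$ of elements $x$ of vertex groups; each class has exactly one representative $\mathcal X_{H'}$ in the vertex group at each $H'\in\alpha$, and $\mathbb G$ is an abelian group, ordered by inclusion of representatives. A *maximal integral* element is an $I\in\mathcal F_v(\alpha)$ that is a maximal divisorial left $\mathcal O_l(I)$-ideal. For a cancellative semigroup $S$ with identity and $a\in S$, a rigid factorization of $a$ is the class of a tuple $(\varepsilon,u_1,\dots,u_k)$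 with $\varepsilon\in S^\times$, $k\ge 0$, atoms $u_1,\dots,u_k$ and $a=\varepsilon u_1\cdots u_k$, two tuples of the same length $k$ and with the same product being identified if $k=0$ or if they differ only by inserting units $\delta^{-1}\delta$ between consecutive factors. $\mathsf Z^*_S(a)$ is the set of rigid factorizations of $a$, and $\mathsf L_S(a)\subset\mathbb N_0$ is the set of their lengths $k$. For a subset $C_M$ of an abelian group $C$, $\mathcal B(C_M)$ is the monoid of zero-sum sequences over $C_M$. A *transfer homomorphism* to a reduced cancellative monoid $B$ is a surjective homomorphism $\theta\colon S\to B$ with $\theta^{-1}(1)=S^\times$ such that $\theta(a)=b_1b_2$ implies $a=a_1a_2$ with $\theta(a_i)=b_i$ for some $a_1,a_2\in S$. **Theorem.** Let $Q$ be a quotient semigroup, $H$ an arithmetical maximal order in $Q$, and $\alpha$ the set of maximal orders equivalent to $H$. 1. For all $a\in H^\bullet$, $\mathsf L_{H^\bullet}(a)$ is finite and non-empty. If, for every $H'\in\alpha$ and every maximal divisorial $H'$-ideal $P$, the number of maximal divisorial left $H'$-ideals $I$ with $P\subset I$ is finite, then $\mathsf Z^*_{H^\bullet}(a)$ is finite for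 all $a\in H^\bullet$. 2. There is a unique groupoid epimorphism $\eta\colon\mathcal F_v(\alpha)\to\mathbb G$ (the abstract norm) such that, for every maximal integral $u$, $\eta(u)$ is the supremum in $\mathbb G$ of all $\mathcal X$ with $\mathcal X_{\mathcal O_l(u)}\subset u$. Let $P_{H^\bullet}=\{\eta(Hq): q\in Q^\bullet\}\subset\mathbb G$, $C=\mathbb G/P_{H^\bullet}$ and $C_M=\{[\eta(I)]\in C: I\in\mathcal F_v(\alpha)\text{ maximal integral}\}$. Assume: (i) a divisorial fractional left $H$-ideal $I$ is principal if and only if $\eta(I)\in P_{H^\bullet}$; (ii) for all $H'\in\alpha$ and all $g\in C_M$ there exists a maximal divisorial left $H'$-ideal $I$ with $[\eta(I)]=g$. Then there exists a transfer homomorphism $\theta\colon H^\bullet\to\mathcal B(C_M)$. -/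

import Mathlib

open CategoryTheory
open scoped Pointwise

/-! ## Factorizations in monoids and transfer homomorphisms -/

section Factorizations

variable {M : Type*} [Monoid M]

/-- The cancellative elements of a semigroup with identity. -/
def cancellativeElements (M : Type*) [Monoid M] : Submonoid M where
  carrier := {a | IsRegular a}
  one_mem' := isRegular_one
  mul_mem' := fun ha hb => ha.mul hb

/-- A formal word `(ε, u₁, …, u_k)`, consisting of a unit `ε` and of atoms `u₁, …, u_k`
(`k = 0` is allowed). -/
structure RigidWord (M : Type*) [Monoid M] where
  unit : Mˣ
  atoms : List M
  irreducible : ∀ u ∈ atoms, Irreducible u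

/-- The element `ε u₁ ⋯ u_k`. -/
def RigidWord.value (w : RigidWord M) : M := w.unit * w.atoms.prod

/-- `(ε, u₁, …, u_k) ∼ (ε', v₁, …, v_l)`: the lengths and the values agree, and there are units
`δ₂, …, δ_k` and `δ_{k+1} = 1` with `ε' v₁ = ε u₁ δ₂⁻¹` and `v_i = δ_i u_i δ_{i+1}⁻¹` for
`2 ≤ i ≤ k`. In the code indices start at `0`, and `δ 0 = ε'⁻¹ ε`, so that the condition on `v₁`
has the same shape as the others (for `k = 0` it says `ε = ε'`). -/
def RigidWord.Rel (w w' : RigidWord M) : Prop :=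
  w.value = w'.value ∧ ∃ h : w.atoms.length = w'.atoms.length, ∃ δ : ℕ → Mˣ,
    δ 0 = w'.unit⁻¹ * w.unit ∧ δ w.atoms.length = 1 ∧
    ∀ (i : ℕ) (hi : i < w.atoms.length),
      w'.atoms[i] = (δ i : M) * w.atoms[i] * ((δ (i + 1))⁻¹ : Mˣ)

instance RigidWord.setoid (M : Type*) [Monoid M] : Setoid (RigidWord M) where
  r := RigidWord.Rel
  iseqv :=
    { refl := fun w => ⟨rfl, rfl, fun _ => 1, by simp, rfl, by simp⟩
      symm := by
        rintro w w' ⟨hv, hl, δ, h0, h1, h⟩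
        refine ⟨hv.symm, hl.symm, fun i => (δ i)⁻¹, by simp [h0], by simp [← hl, h1], ?_⟩
        intro i hi
        rw [h i (hl ▸ hi)]
        simp [mul_assoc]
      trans := by
        rintro w w' w'' ⟨hv, hl, δ, h0, h1, h⟩ ⟨hv', hl', δ', h0', h1', h'⟩
        refine ⟨hv.trans hv', hl.trans hl', fun i => δ' i * δ i, by simp [h0, h0', mul_assoc], ?_, ?_⟩
        · have : δ' w.atoms.length = 1 := by rw [hl]; exact h1'
          simp [h1, this]
        · intro i hi
          rw [h' i (hl ▸ hi), h i hi]
          simp [mul_assoc] }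

/-- The rigid factorizations of the elements of `M`. -/
def RigidFactorization (M : Type*) [Monoid M] : Type _ := Quotient (RigidWord.setoid M)

/-- The element of which `z` is a factorization. -/
def RigidFactorization.value (z : RigidFactorization M) : M :=
  Quotient.lift (s := RigidWord.setoid M) RigidWord.value (fun _ _ h => h.1) z

/-- The number of atoms of `z`. -/
def RigidFactorization.length (z : RigidFactorization M) : ℕ :=
  Quotient.lift (s := RigidWord.setoid M) (fun w => w.atoms.length) (fun _ _ h => h.2.1) z

/-- The set of rigid factorizations of `a`. -/
def rigidFactorizations (a : M) : Set (RigidFactorization M) := {z | z.value = a}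

/-- The set of lengths of `a`. -/
def lengthSet (a : M) : Set ℕ := RigidFactorization.length '' rigidFactorizations a

/-- The monoid of zero-sum sequences over a subset `S` of an abelian group `C`. The group is
written multiplicatively, so the "sum" of a sequence is its product in `C`. -/
def zeroSumSequences {C : Type*} [CommGroup C] (S : Set C) :
    Submonoid (Multiplicative (Multiset S)) where
  carrier := {T | ((Multiplicative.toAdd T).map (fun g : S => (g : C))).prod = 1}
  one_mem' := by simp
  mul_mem' := by
    intro a b ha hb
    simp only [Set.mem_ofPred_eq] at ha hb
    simp [ha, hb]

/-- A transfer homomorphism from `M` to a reduced cancellative monoid `B`. -/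
structure IsTransferHom {B : Type*} [Monoid B] (θ : M →* B) : Prop where
  surjective : Function.Surjective θ
  eq_one_iff : ∀ a, θ a = 1 ↔ IsUnit a
  lift_mul : ∀ (a : M) (b₁ b₂ : B), θ a = b₁ * b₂ →
    ∃ a₁ a₂ : M, a = a₁ * a₂ ∧ θ a₁ = b₁ ∧ θ a₂ = b₂

end Factorizations

/-! ## The universal vertex group of a groupoid -/

section VertexGroup

variable (G : Type*) [Groupoid G]

/-- The universal vertex group of a groupoid. For a connected groupoid with abelian vertex groups
its elements are the conjugacy classes `𝒳 = (x) = {a⁻¹ x a}` of elements `x` of vertex groups. Such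
a class has exactly one representative `𝒳_e` in each vertex group `G(e)`, and it is encoded here as
the family of these representatives, with `𝒳_f = a⁻¹ 𝒳_e a` for all `a ∈ G(e, f)`. -/
def universalVertexGroup : Subgroup (∀ e : G, (e ⟶ e)) where
  carrier := {x | ∀ (e f : G) (a : e ⟶ f), Groupoid.vertexGroupIsomOfMap a (x e) = x f}
  one_mem' := fun e f a => map_one _
  mul_mem' := by
    intro x y hx hy e f a
    rw [Pi.mul_apply, Pi.mul_apply, map_mul, hx, hy]
  inv_mem' := by
    intro x hx e f a
    rw [Pi.inv_apply, Pi.inv_apply, map_inv, hx]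

variable {G}

instance : CommGroup (universalVertexGroup G) :=
  { (inferInstance : Group (universalVertexGroup G)) with
    mul_comm := by
      intro x y
      ext e : 2
      have h := x.2 e e (y.1 e)
      change x.1 e ≫ y.1 e = y.1 e ≫ x.1 e
      rw [← h, Groupoid.vertexGroupIsomOfMap_apply]
      simp only [Category.assoc]
      have h' := congrArg (fun t => t ≫ y.1 e) h
      simpa using h' }

/-- In a connected groupoid with abelian vertex groups, every element of a vertex group represents
exactly one element of the universal vertex group. -/
theorem universalVertexGroup_eval_bijective (hconn : ∀ e f : G, Nonempty (e ⟶ f))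
    (hcomm : ∀ (e : G) (x y : e ⟶ e), x * y = y * x) (e : G) :
    Function.Bijective (fun x : universalVertexGroup G => x.1 e) := by
  constructor
  · intro x y h
    ext f : 2
    obtain ⟨a⟩ := hconn e f
    rw [← x.2 e f a, ← y.2 e f a]
    exact congrArg _ h
  · intro x
    choose c hc using fun f => exists_true_iff_nonempty.mpr (hconn e f)
    have key : ∀ (f : G) (a b : e ⟶ f), Groupoid.vertexGroupIsomOfMap a x =
        Groupoid.vertexGroupIsomOfMap b x := by
      intro f a b
      have h := hcomm e x (b ≫ Groupoid.inv a)
      simp only [Groupoid.vertexGroup_mul] at h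
      simp only [Groupoid.vertexGroupIsomOfMap_apply]
      have h2 := congrArg (fun t => Groupoid.inv b ≫ t ≫ a) h
      simpa [Category.assoc] using h2.symm
    refine ⟨⟨fun f => Groupoid.vertexGroupIsomOfMap (c f) x, ?_⟩, ?_⟩
    · intro f g a
      change Groupoid.vertexGroupIsomOfMap a (Groupoid.vertexGroupIsomOfMap (c f) x) =
        Groupoid.vertexGroupIsomOfMap (c g) x
      rw [key g (c g) (c f ≫ a)]
      simp [Groupoid.vertexGroupIsomOfMap]
    · change Groupoid.vertexGroupIsomOfMap (c e) x = x
      rw [key e (c e) (𝟙 e)]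
      simp [Groupoid.vertexGroupIsomOfMap]

end VertexGroup

/-! ## Orders in a quotient semigroup and their one-sided ideals

In a quotient semigroup `Q` the cancellative elements are the units, so that `Q^• = Qˣ`. Semigroups
have an identity element, and subsemigroups contain it. -/

section Ideals

variable {Q : Type*} [Monoid Q]

/-- Every cancellative element of `Q` is invertible. -/
def IsQuotientSemigroup (Q : Type*) [Monoid Q] : Prop := ∀ a : Q, IsRegular a → IsUnit a

/-- `H` is a (left and right) order in `Q`. -/
structure IsOrder (H : Submonoid Q) : Prop where
  right : ∀ q : Q, ∃ a ∈ H, ∃ s : Qˣ, (s : Q) ∈ H ∧ q = a * ((s⁻¹ : Qˣ) : Q)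
  left : ∀ q : Q, ∃ a ∈ H, ∃ s : Qˣ, (s : Q) ∈ H ∧ q = ((s⁻¹ : Qˣ) : Q) * a

/-- Asano equivalence of orders. -/
def OrderEquiv (H H' : Submonoid Q) : Prop :=
  (∃ a b : Qˣ, ∀ h ∈ H, (a : Q) * h * b ∈ H') ∧ (∃ c d : Qˣ, ∀ h ∈ H', (c : Q) * h * d ∈ H)

/-- `H` is an order that is maximal in its equivalence class. -/
def IsMaximalOrder (H : Submonoid Q) : Prop :=
  IsOrder H ∧ ∀ H' : Submonoid Q, IsOrder H' → OrderEquiv H H' → H ≤ H' → H' = H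

/-- `(Y :_r X) = {q | X q ⊆ Y}`. -/
def rightColon (Y X : Set Q) : Set Q := {q | ∀ x ∈ X, x * q ∈ Y}

/-- `(Y :_l X) = {q | q X ⊆ Y}`. -/
def leftColon (Y X : Set Q) : Set Q := {q | ∀ x ∈ X, q * x ∈ Y}

/-- The left order `(X :_l X)` of `X`. -/
def leftOrder (X : Set Q) : Submonoid Q where
  carrier := leftColon X X
  one_mem' := fun x hx => by simpa using hx
  mul_mem' := fun {a b} ha hb x hx => by rw [mul_assoc]; exact ha _ (hb _ hx)

/-- The right order `(X :_r X)` of `X`. -/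
def rightOrder (X : Set Q) : Submonoid Q where
  carrier := rightColon X X
  one_mem' := fun x hx => by simpa using hx
  mul_mem' := fun {a b} ha hb x hx => by rw [← mul_assoc]; exact hb _ (ha _ hx)

/-- `X⁻¹ = {q | X q X ⊆ X}`. -/
def fracInv (X : Set Q) : Set Q := {q | ∀ x ∈ X, ∀ y ∈ X, x * q * y ∈ X}

/-- `X_v = (X⁻¹)⁻¹`. -/
def vClosure (X : Set Q) : Set Q := fracInv (fracInv X)

structure IsFracLeftIdeal (H : Submonoid Q) (I : Set Q) : Prop where
  smul_mem : ∀ h ∈ H, ∀ x ∈ I, h * x ∈ I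
  exists_unit : ∃ u : Qˣ, (u : Q) ∈ I
  exists_denom : ∃ u : Qˣ, (u : Q) ∈ rightColon (H : Set Q) I

structure IsFracRightIdeal (H : Submonoid Q) (I : Set Q) : Prop where
  mul_mem : ∀ h ∈ H, ∀ x ∈ I, x * h ∈ I
  exists_unit : ∃ u : Qˣ, (u : Q) ∈ I
  exists_denom : ∃ u : Qˣ, (u : Q) ∈ leftColon (H : Set Q) I

def IsDivisorial (I : Set Q) : Prop := vClosure I = I

/-- `I` is a divisorial left `H`-ideal. -/
def IsDivisorialLeftIdeal (H : Submonoid Q) (I : Set Q) : Prop :=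
  IsFracLeftIdeal H I ∧ I ⊆ H ∧ IsDivisorial I

/-- `I` is a divisorial right `H`-ideal. -/
def IsDivisorialRightIdeal (H : Submonoid Q) (I : Set Q) : Prop :=
  IsFracRightIdeal H I ∧ I ⊆ H ∧ IsDivisorial I

/-- `I` is a maximal divisorial left `H`-ideal, i.e. maximal among those different from `H`. -/
def IsMaximalDivisorialLeftIdeal (H : Submonoid Q) (I : Set Q) : Prop :=
  Maximal (fun J : Set Q => IsDivisorialLeftIdeal H J ∧ J ≠ H) I

/-- `P` is a maximal divisorial (two-sided) `H`-ideal. -/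
def IsMaximalDivisorialIdeal (H : Submonoid Q) (P : Set Q) : Prop :=
  Maximal (fun J : Set Q => IsDivisorialLeftIdeal H J ∧ IsDivisorialRightIdeal H J ∧ J ≠ H) P

/-- Every fractional left and every fractional right `H`-ideal contains a fractional two-sided
`H`-ideal. -/
def IsBoundedOrder (H : Submonoid Q) : Prop :=
  ∀ I : Set Q, IsFracLeftIdeal H I ∨ IsFracRightIdeal H I →
    ∃ J : Set Q, IsFracLeftIdeal H J ∧ IsFracRightIdeal H J ∧ J ⊆ I

/-- An arithmetical maximal order. In the lattices in question the meet is `I ∩ J` and the join is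
`(I ∪ J)_v`. -/
structure IsArithmeticalMaximalOrder (H : Submonoid Q) : Prop where
  isMaximalOrder : IsMaximalOrder H
  acc_left : WellFoundedGT {I : Set Q // IsDivisorialLeftIdeal H I}
  acc_right : WellFoundedGT {I : Set Q // IsDivisorialRightIdeal H I}
  bounded : IsBoundedOrder H
  modular_left : ∀ I J K : Set Q, IsFracLeftIdeal H I → IsDivisorial I →
    IsFracLeftIdeal H J → IsDivisorial J → IsFracLeftIdeal H K → IsDivisorial K → I ⊆ K →
    vClosure (I ∪ J) ∩ K = vClosure (I ∪ (J ∩ K))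
  modular_right : ∀ I J K : Set Q, IsDivisorialRightIdeal H I → IsDivisorialRightIdeal H J →
    IsDivisorialRightIdeal H K → I ⊆ K →
    vClosure (I ∪ J) ∩ K = vClosure (I ∪ (J ∩ K))

/-! ### Fractional ideals over two maximal orders -/

theorem OrderEquiv.refl (H : Submonoid Q) : OrderEquiv H H :=
  ⟨⟨1, 1, by simp⟩, ⟨1, 1, by simp⟩⟩

theorem IsOrder.of_le {H H' : Submonoid Q} (hH : IsOrder H) (h : H ≤ H') : IsOrder H' where
  right q := by
    obtain ⟨a, ha, s, hs, e⟩ := hH.right q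
    exact ⟨a, h ha, s, h hs, e⟩
  left q := by
    obtain ⟨a, ha, s, hs, e⟩ := hH.left q
    exact ⟨a, h ha, s, h hs, e⟩

theorem leftOrder_eq {A : Submonoid Q} (hA : IsMaximalOrder A) {I : Set Q}
    (hI : IsFracLeftIdeal A I) : leftOrder I = A := by
  have hle : A ≤ leftOrder I := fun a ha x hx => hI.smul_mem a ha x hx
  obtain ⟨u, hu⟩ := hI.exists_unit
  obtain ⟨w, hw⟩ := hI.exists_denom
  refine hA.2 _ (hA.1.of_le hle) ⟨⟨1, 1, fun h hh => by simpa using hle hh⟩, 1, u * w, ?_⟩ hle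
  intro h hh
  have := hw _ (hh _ hu)
  simpa [mul_assoc] using this

theorem rightOrder_eq {B : Submonoid Q} (hB : IsMaximalOrder B) {I : Set Q}
    (hI : IsFracRightIdeal B I) : rightOrder I = B := by
  have hle : B ≤ rightOrder I := fun a ha x hx => hI.mul_mem a ha x hx
  obtain ⟨u, hu⟩ := hI.exists_unit
  obtain ⟨w, hw⟩ := hI.exists_denom
  refine hB.2 _ (hB.1.of_le hle) ⟨⟨1, 1, fun h hh => by simpa using hle hh⟩, w * u, 1, ?_⟩ hle
  intro h hh
  have := hw _ (hh _ hu)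
  simpa [mul_assoc] using this

/-- `I` is a fractional `(A, B)`-ideal. -/
def IsFracBiIdeal (A B : Submonoid Q) (I : Set Q) : Prop :=
  IsFracLeftIdeal A I ∧ IsFracRightIdeal B I

namespace IsFracBiIdeal

variable {A B C : Submonoid Q} {I J K : Set Q}

theorem mem_inv_left (hA : IsMaximalOrder A) (hI : IsFracBiIdeal A B I) {q : Q} :
    q ∈ fracInv I ↔ ∀ x ∈ I, x * q ∈ A := by
  rw [← leftOrder_eq hA hI.1]
  exact Iff.rfl

theorem mem_inv_right (hB : IsMaximalOrder B) (hI : IsFracBiIdeal A B I) {q : Q} :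
    q ∈ fracInv I ↔ ∀ x ∈ I, q * x ∈ B := by
  rw [← rightOrder_eq hB hI.2]
  constructor
  · intro h x hx y hy
    rw [← mul_assoc]
    exact h y hy x hx
  · intro h x hx y hy
    rw [mul_assoc]
    exact h y hy x hx

theorem inv (hA : IsMaximalOrder A) (hB : IsMaximalOrder B) (hI : IsFracBiIdeal A B I) :
    IsFracBiIdeal B A (fracInv I) := by
  obtain ⟨u, hu⟩ := hI.1.exists_unit
  obtain ⟨w, hw⟩ := hI.1.exists_denom
  have hw' : (w : Q) ∈ fracInv I := (hI.mem_inv_left hA).2 hw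
  refine ⟨⟨?_, ⟨w, hw'⟩, ⟨u, ?_⟩⟩, ⟨?_, ⟨w, hw'⟩, ⟨u, ?_⟩⟩⟩
  · intro b hb q hq x hx y hy
    rw [← mul_assoc]
    exact hq _ (hI.2.mul_mem b hb x hx) y hy
  · intro q hq
    exact (hI.mem_inv_right hB).1 hq _ hu
  · intro a ha q hq x hx y hy
    have := hq x hx _ (hI.1.smul_mem a ha y hy)
    simpa [mul_assoc] using this
  · intro q hq
    exact (hI.mem_inv_left hA).1 hq _ hu

theorem vcl (hA : IsMaximalOrder A) (hB : IsMaximalOrder B) (hI : IsFracBiIdeal A B I) :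
    IsFracBiIdeal A B (vClosure I) := (hI.inv hA hB).inv hB hA

theorem subset_vcl (hA : IsMaximalOrder A) (hB : IsMaximalOrder B) (hI : IsFracBiIdeal A B I) :
    I ⊆ vClosure I := fun x hx =>
  ((hI.inv hA hB).mem_inv_left hB).2 fun _ hq => (hI.mem_inv_right hB).1 hq x hx

theorem inv_vcl (hA : IsMaximalOrder A) (hB : IsMaximalOrder B) (hI : IsFracBiIdeal A B I) :
    fracInv (vClosure I) = fracInv I := by
  apply Set.Subset.antisymm
  · intro q hq
    exact (hI.mem_inv_left hA).2 fun x hx =>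
      ((hI.vcl hA hB).mem_inv_left hA).1 hq x (hI.subset_vcl hA hB hx)
  · exact (hI.inv hA hB).subset_vcl hB hA

theorem mul (hI : IsFracBiIdeal A B I) (hJ : IsFracBiIdeal B C J) :
    IsFracBiIdeal A C (I * J) := by
  obtain ⟨u, hu⟩ := hI.1.exists_unit
  obtain ⟨u', hu'⟩ := hJ.1.exists_unit
  obtain ⟨w, hw⟩ := hI.1.exists_denom
  obtain ⟨w', hw'⟩ := hJ.1.exists_denom
  obtain ⟨z, hz⟩ := hI.2.exists_denom
  obtain ⟨z', hz'⟩ := hJ.2.exists_denom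
  have huu : ((u * u' : Qˣ) : Q) ∈ I * J := Set.mul_mem_mul hu hu'
  refine ⟨⟨?_, ⟨_, huu⟩, ⟨w' * w, ?_⟩⟩, ⟨?_, ⟨_, huu⟩, ⟨z' * z, ?_⟩⟩⟩
  · rintro a ha _ ⟨x, hx, y, hy, rfl⟩
    exact ⟨a * x, hI.1.smul_mem a ha x hx, y, hy, mul_assoc _ _ _⟩
  · rintro _ ⟨x, hx, y, hy, rfl⟩
    have := hw _ (hI.2.mul_mem _ (hw' y hy) x hx)
    simpa [mul_assoc] using this
  · rintro c hc _ ⟨x, hx, y, hy, rfl⟩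
    exact ⟨x, hx, y * c, hJ.2.mul_mem c hc y hy, (mul_assoc _ _ _).symm⟩
  · rintro _ ⟨x, hx, y, hy, rfl⟩
    have := hz' _ (hJ.1.smul_mem _ (hz x hx) y hy)
    simpa [mul_assoc] using this

theorem self (A : Submonoid Q) : IsFracBiIdeal A A (A : Set Q) :=
  ⟨⟨fun _ ha _ hx => A.mul_mem ha hx, ⟨1, A.one_mem⟩, ⟨1, fun x hx => by simpa using hx⟩⟩,
    ⟨fun _ ha _ hx => A.mul_mem hx ha, ⟨1, A.one_mem⟩, ⟨1, fun x hx => by simpa using hx⟩⟩⟩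

theorem inv_self (hA : IsMaximalOrder A) : fracInv (A : Set Q) = A := by
  ext q
  rw [(self A).mem_inv_left hA]
  exact ⟨fun h => by simpa using h 1 A.one_mem, fun h x hx => A.mul_mem hx h⟩

theorem vcl_self (hA : IsMaximalOrder A) : vClosure (A : Set Q) = A := by
  rw [vClosure, inv_self hA, inv_self hA]

theorem self_mul (hI : IsFracBiIdeal A B I) : (A : Set Q) * I = I := by
  apply Set.Subset.antisymm
  · rintro _ ⟨a, ha, x, hx, rfl⟩
    exact hI.1.smul_mem a ha x hx
  · intro x hx
    exact ⟨1, A.one_mem, x, hx, one_mul x⟩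

theorem mul_self (hI : IsFracBiIdeal A B I) : I * (B : Set Q) = I := by
  apply Set.Subset.antisymm
  · rintro _ ⟨x, hx, b, hb, rfl⟩
    exact hI.2.mul_mem b hb x hx
  · intro x hx
    exact ⟨x, hx, 1, B.one_mem, mul_one x⟩

theorem vcl_vcl_mul (hA : IsMaximalOrder A) (hB : IsMaximalOrder B)
    (hI : IsFracBiIdeal A B I) (hJ : IsFracBiIdeal B C J) :
    vClosure (vClosure I * J) = vClosure (I * J) := by
  unfold vClosure
  congr 1
  change fracInv (vClosure I * J) = fracInv (I * J)
  ext q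
  rw [((hI.vcl hA hB).mul hJ).mem_inv_left hA, (hI.mul hJ).mem_inv_left hA]
  have key : ∀ X : Set Q, IsFracBiIdeal A B X →
      ((∀ x ∈ X * J, x * q ∈ A) ↔ ∀ y ∈ J, y * q ∈ fracInv X) := by
    intro X hX
    constructor
    · intro h y hy
      refine (hX.mem_inv_left hA).2 fun x hx => ?_
      rw [← mul_assoc]
      exact h _ (Set.mul_mem_mul hx hy)
    · rintro h _ ⟨x, hx, y, hy, rfl⟩
      have := (hX.mem_inv_left hA).1 (h y hy) x hx
      rwa [← mul_assoc] at this
  rw [key _ (hI.vcl hA hB), key _ hI, hI.inv_vcl hA hB]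

theorem vcl_mul_vcl (hB : IsMaximalOrder B) (hC : IsMaximalOrder C)
    (hI : IsFracBiIdeal A B I) (hJ : IsFracBiIdeal B C J) :
    vClosure (I * vClosure J) = vClosure (I * J) := by
  unfold vClosure
  congr 1
  change fracInv (I * vClosure J) = fracInv (I * J)
  ext q
  rw [(hI.mul (hJ.vcl hB hC)).mem_inv_right hC, (hI.mul hJ).mem_inv_right hC]
  have key : ∀ X : Set Q, IsFracBiIdeal B C X →
      ((∀ x ∈ I * X, q * x ∈ C) ↔ ∀ y ∈ I, q * y ∈ fracInv X) := by
    intro X hX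
    constructor
    · intro h y hy
      refine (hX.mem_inv_right hC).2 fun x hx => ?_
      rw [mul_assoc]
      exact h _ (Set.mul_mem_mul hy hx)
    · rintro h _ ⟨x, hx, y, hy, rfl⟩
      have := (hX.mem_inv_right hC).1 (h x hx) y hy
      rwa [mul_assoc] at this
  rw [key _ (hJ.vcl hB hC), key _ hJ, hJ.inv_vcl hB hC]

theorem vcl_mul_inv (hA : IsMaximalOrder A) (hB : IsMaximalOrder B) (hI : IsFracBiIdeal A B I) :
    vClosure (I * fracInv I) = A := by
  have hinv := hI.inv hA hB
  have h : fracInv (I * fracInv I) = A := by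
    ext q
    rw [(hI.mul hinv).mem_inv_left hA, SetLike.mem_coe, ← rightOrder_eq hA hinv.2]
    constructor
    · intro h y hy
      refine (hI.mem_inv_left hA).2 fun x hx => ?_
      rw [← mul_assoc]
      have := h _ (Set.mul_mem_mul hx hy)
      rwa [rightOrder_eq hA hinv.2] at this
    · rintro h _ ⟨x, hx, y, hy, rfl⟩
      rw [rightOrder_eq hA hinv.2]
      have := (hI.mem_inv_left hA).1 (h y hy) x hx
      rwa [← mul_assoc] at this
  rw [vClosure, h, inv_self hA]

end IsFracBiIdeal

/-! ### The groupoid of divisorial fractional one-sided ideals -/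

/-- The set `α` of maximal orders equivalent to `H`. -/
structure MaximalOrderClass (H : Submonoid Q) where
  order : Submonoid Q
  isMaximalOrder : IsMaximalOrder order
  equiv : OrderEquiv H order

/-- `H` itself as an element of `α`. -/
def MaximalOrderClass.base {H : Submonoid Q} (hH : IsMaximalOrder H) : MaximalOrderClass H :=
  ⟨H, hH, OrderEquiv.refl H⟩

variable {H : Submonoid Q}

/-- The set `F_v(α)` of all divisorial fractional left (or right) `H'`-ideals with `H' ∈ α`. -/
def divisorialFracIdeals (H : Submonoid Q) : Set (Set Q) :=
  {I | IsDivisorial I ∧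
    ∃ H' : MaximalOrderClass H, IsFracLeftIdeal H'.order I ∨ IsFracRightIdeal H'.order I}

/-- The morphisms from `A` to `B` in `F_v(α)`: its elements with left order `A` and right
order `B`. -/
@[ext]
structure DivisorialHom (A B : MaximalOrderClass H) where
  carrier : Set Q
  mem : carrier ∈ divisorialFracIdeals H
  leftOrder_eq : leftOrder carrier = A.order
  rightOrder_eq : rightOrder carrier = B.order

theorem DivisorialHom.isFracBiIdeal {A B : MaximalOrderClass H} (I : DivisorialHom A B) :
    IsFracBiIdeal A.order B.order I.carrier := by
  obtain ⟨I, ⟨-, H', hI⟩, hl, hr⟩ := I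
  rw [← hl, ← hr]
  rcases hI with hI | hI
  · obtain ⟨w, hw⟩ := hI.exists_denom
    refine ⟨by rw [_root_.leftOrder_eq H'.isMaximalOrder hI]; exact hI,
      ⟨fun b hb x hx => hb x hx, hI.exists_unit, w, fun x hx y hy => ?_⟩⟩
    rw [← mul_assoc]
    exact hI.smul_mem _ (hw y hy) x hx
  · obtain ⟨w, hw⟩ := hI.exists_denom
    refine ⟨⟨fun a ha x hx => ha x hx, hI.exists_unit, w, fun x hx y hy => ?_⟩,
      by rw [_root_.rightOrder_eq H'.isMaximalOrder hI]; exact hI⟩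
    rw [mul_assoc]
    exact hI.mul_mem _ (hw y hy) x hx

/-- A divisorial fractional `(A, B)`-ideal as a morphism. -/
def IsFracBiIdeal.toHom {A B : MaximalOrderClass H} {I : Set Q}
    (hI : IsFracBiIdeal A.order B.order I) (hv : IsDivisorial I) : DivisorialHom A B :=
  ⟨I, ⟨hv, A, Or.inl hI.1⟩, leftOrder_eq A.isMaximalOrder hI.1,
    rightOrder_eq B.isMaximalOrder hI.2⟩

/-- The groupoid `F_v(α)`. Its objects are the maximal orders in `α`, the composition is the
`v`-product `I ·_v J = (I J)_v`, defined when the right order of `I` is the left order of `J`. -/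
instance : Groupoid (MaximalOrderClass H) where
  Hom A B := DivisorialHom A B
  id A := (IsFracBiIdeal.self A.order).toHom (IsFracBiIdeal.vcl_self A.isMaximalOrder)
  comp {A B C} I J :=
    IsFracBiIdeal.toHom (I := vClosure (I.carrier * J.carrier))
      ((I.isFracBiIdeal.mul J.isFracBiIdeal).vcl A.isMaximalOrder C.isMaximalOrder)
      (congrArg fracInv
        ((I.isFracBiIdeal.mul J.isFracBiIdeal).inv_vcl A.isMaximalOrder C.isMaximalOrder))
  id_comp {A B} I := DivisorialHom.ext <| by
    change vClosure ((A.order : Set Q) * I.carrier) = I.carrier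
    rw [I.isFracBiIdeal.self_mul]
    exact I.mem.1
  comp_id {A B} I := DivisorialHom.ext <| by
    change vClosure (I.carrier * (B.order : Set Q)) = I.carrier
    rw [I.isFracBiIdeal.mul_self]
    exact I.mem.1
  assoc {A B C D} I J K := DivisorialHom.ext <| by
    change vClosure (vClosure (I.carrier * J.carrier) * K.carrier) =
      vClosure (I.carrier * vClosure (J.carrier * K.carrier))
    rw [(I.isFracBiIdeal.mul J.isFracBiIdeal).vcl_vcl_mul A.isMaximalOrder C.isMaximalOrder
        K.isFracBiIdeal,
      I.isFracBiIdeal.vcl_mul_vcl B.isMaximalOrder D.isMaximalOrder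
        (J.isFracBiIdeal.mul K.isFracBiIdeal), mul_assoc]
  inv {A B} I :=
    (I.isFracBiIdeal.inv A.isMaximalOrder B.isMaximalOrder).toHom (congrArg fracInv I.mem.1)
  inv_comp {A B} I := DivisorialHom.ext <| by
    change vClosure (fracInv I.carrier * I.carrier) = B.order
    have h := (I.isFracBiIdeal.inv A.isMaximalOrder B.isMaximalOrder).vcl_mul_inv
      B.isMaximalOrder A.isMaximalOrder
    have h' : fracInv (fracInv I.carrier) = I.carrier := I.mem.1
    rwa [h'] at h
  comp_inv {A B} I := DivisorialHom.ext
    (I.isFracBiIdeal.vcl_mul_inv A.isMaximalOrder B.isMaximalOrder)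

/-- The underlying subset of `Q` of an element of `F_v(α)`. -/
def idealSet {A B : MaximalOrderClass H} (I : A ⟶ B) : Set Q := DivisorialHom.carrier I

/-- Elements of `F_v(α)` are ordered by inclusion. -/
instance (A B : MaximalOrderClass H) : PartialOrder (A ⟶ B) :=
  PartialOrder.lift idealSet (fun _ _ h => DivisorialHom.ext h)

/-! ### The abstract norm and the class group -/

/-- `η` is the abstract norm of `F_v(α)`: an epimorphism of groupoids onto the universal vertex
group `𝔾` such that `η(u) = Φ(u)` for all maximal integral `u`, where `Φ(u)` is the supremum in `𝔾`
of all `𝒳` with `𝒳_{s(u)} ≤ u`. (The order on `𝔾` is the inclusion of representatives.) -/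
structure IsAbstractNorm
    (η : ∀ A B : MaximalOrderClass H, (A ⟶ B) → universalVertexGroup (MaximalOrderClass H)) :
    Prop where
  map_comp : ∀ {A B C : MaximalOrderClass H} (I : A ⟶ B) (J : B ⟶ C), η A C (I ≫ J) = η A B I * η B C J
  surjective : ∀ 𝒳, ∃ (A B : MaximalOrderClass H) (I : A ⟶ B), η A B I = 𝒳
  eq_lowerBound : ∀ {A B : MaximalOrderClass H} (u : A ⟶ B),
    IsMaximalDivisorialLeftIdeal A.order (idealSet u) →
    IsLUB {𝒳 : universalVertexGroup (MaximalOrderClass H) | idealSet (𝒳.1 A) ⊆ idealSet u}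
      (η A B u)

section Classes

variable (hH : IsMaximalOrder H)
  (η : ∀ A B : MaximalOrderClass H, (A ⟶ B) → universalVertexGroup (MaximalOrderClass H))

/-- The set of all `η(Hq)` with `q ∈ Q^•`. -/
def principalNorms : Set (universalVertexGroup (MaximalOrderClass H)) :=
  {𝒳 | ∃ (q : Qˣ) (B : MaximalOrderClass H) (I : MaximalOrderClass.base hH ⟶ B),
    idealSet I = (H : Set Q) * {(q : Q)} ∧ η _ B I = 𝒳}

/-- The class group `C`, the quotient of `𝔾` by (the subgroup generated by) all `η(Hq)`. -/
abbrev NormClassGroup : Type _ :=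
  universalVertexGroup (MaximalOrderClass H) ⧸ Subgroup.closure (principalNorms hH η)

/-- The class `[η(I)]` in `C`. -/
def normClass {A B : MaximalOrderClass H} (I : A ⟶ B) : NormClassGroup hH η :=
  QuotientGroup.mk (η A B I)

/-- The set `C_M` of the classes of maximal integral elements. -/
def maximalClasses : Set (NormClassGroup hH η) :=
  {g | ∃ (A B : MaximalOrderClass H) (I : A ⟶ B),
    IsMaximalDivisorialLeftIdeal A.order (idealSet I) ∧ normClass hH η I = g}

end Classes

end Ideals

/-!
A divisorial fractional left ideal of `A ∈ α` has a maximal order in `α` as its right order, so that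
it is an arrow of `F_v(α)`, and inclusion of left `A`-ideals is divisibility: `I ⊆ J` if and only if
`J⁻¹ I` is integral. Hence everything about factorizations of an integral `I` into maximal integral
elements is a statement about maximal chains in the interval `[I, A]` of the lattice `DivLeftIdeal A`
of divisorial fractional left `A`-ideals. Multiplication by an arrow identifies the lattices for
different `A` (`DivLeftIdeal.smul`). They are modular, and their intervals satisfy both chain
conditions: the descending one for left ideals is the ascending one for the inverses, which are
right ideals (`locallyFiniteLength_base`).

The vertex groups are abelian because a partially ordered group with binary infima and ACC below `1`
is generated by its coatoms, and distinct coatoms commute (`mul_comm_of_wellFounded`). So each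
two-sided ideal determines an element of `𝔾`. To a step `I ⊆ J` one attaches the largest
`𝒳 ∈ 𝔾` with `𝒳 J ⊆ I` (`DivLeftIdeal.factorNorm`). Perspective steps have the same label, whence by
the Jordan–Hölder argument (`LabelledChain.unique`) the multiset of labels of a maximal chain from
`I` to `J` depends only on `I` and `J`. The product of these labels gives the abstract norm. It is
multiplicative because the labels are invariant under left multiplication by arrows, and it is the
only one because chains determine it.

For `a ∈ H^•` the chain from `Ha` to `H` bounds the lengths of factorizations. Rigid factorizations
of `a` inject into chains of principal ideals in `[Ha, H]`, and this interval is finite if each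
maximal two-sided ideal lies in only finitely many maximal left ideals, since a maximal left ideal is
prime with respect to two-sided ideals (`DivLeftIdeal.finite_Icc`).

The transfer homomorphism sends `a` to the classes of the labels of `[Ha, H]`. It is multiplicative
since labels are also invariant under right multiplication by `Q^•`. Surjectivity is the concatenation
of maximal ideals of prescribed classes, followed by the principality hypothesis. Lifting of products
rests on the fact that two adjacent steps with different labels can be interchanged
(`DivLeftIdeal.exists_swap`), so that every sub-multiset of the labels occurs at the top of
`[Ha, H]`; when its classes multiply to `1`, the intermediate ideal is principal.
-/

/-! ### One-sided fractional ideals and the divisorial closure -/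

section OneSided

variable {Q : Type*} [Monoid Q] {A : Submonoid Q} {I J : Set Q}

theorem IsFracLeftIdeal.mem_inv (hA : IsMaximalOrder A) (hI : IsFracLeftIdeal A I) {q : Q} :
    q ∈ fracInv I ↔ ∀ x ∈ I, x * q ∈ A := by
  rw [← leftOrder_eq hA hI]
  exact Iff.rfl

theorem IsFracRightIdeal.mem_inv (hA : IsMaximalOrder A) (hI : IsFracRightIdeal A I) {q : Q} :
    q ∈ fracInv I ↔ ∀ x ∈ I, q * x ∈ A := by
  rw [← rightOrder_eq hA hI]
  constructor
  · intro h x hx y hy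
    rw [← mul_assoc]
    exact h y hy x hx
  · intro h x hx y hy
    rw [mul_assoc]
    exact h y hy x hx

theorem IsFracLeftIdeal.inv (hA : IsMaximalOrder A) (hI : IsFracLeftIdeal A I) :
    IsFracRightIdeal A (fracInv I) := by
  obtain ⟨u, hu⟩ := hI.exists_unit
  obtain ⟨w, hw⟩ := hI.exists_denom
  refine ⟨fun a ha q hq => ?_, ⟨w, (hI.mem_inv hA).2 hw⟩, ⟨u, fun q hq => ?_⟩⟩
  · rw [hI.mem_inv hA] at hq ⊢
    intro x hx
    rw [← mul_assoc]
    exact A.mul_mem (hq x hx) ha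
  · exact (hI.mem_inv hA).1 hq _ hu

theorem IsFracRightIdeal.inv (hA : IsMaximalOrder A) (hI : IsFracRightIdeal A I) :
    IsFracLeftIdeal A (fracInv I) := by
  obtain ⟨u, hu⟩ := hI.exists_unit
  obtain ⟨w, hw⟩ := hI.exists_denom
  refine ⟨fun a ha q hq => ?_, ⟨w, (hI.mem_inv hA).2 hw⟩, ⟨u, fun q hq => ?_⟩⟩
  · rw [hI.mem_inv hA] at hq ⊢
    intro x hx
    rw [mul_assoc]
    exact A.mul_mem ha (hq x hx)
  · exact (hI.mem_inv hA).1 hq _ hu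

namespace IsFracLeftIdeal

theorem mem_vcl (hA : IsMaximalOrder A) (hI : IsFracLeftIdeal A I) {q : Q} :
    q ∈ vClosure I ↔ ∀ p ∈ fracInv I, q * p ∈ A :=
  (hI.inv hA).mem_inv hA

theorem vcl (hA : IsMaximalOrder A) (hI : IsFracLeftIdeal A I) :
    IsFracLeftIdeal A (vClosure I) :=
  (hI.inv hA).inv hA

theorem subset_vcl (hA : IsMaximalOrder A) (hI : IsFracLeftIdeal A I) : I ⊆ vClosure I :=
  fun x hx => (hI.mem_vcl hA).2 fun _ hp => (hI.mem_inv hA).1 hp x hx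

theorem inv_anti (hA : IsMaximalOrder A) (hI : IsFracLeftIdeal A I) (hJ : IsFracLeftIdeal A J)
    (h : I ⊆ J) : fracInv J ⊆ fracInv I :=
  fun _ hq => (hI.mem_inv hA).2 fun x hx => (hJ.mem_inv hA).1 hq x (h hx)

theorem vcl_mono (hA : IsMaximalOrder A) (hI : IsFracLeftIdeal A I) (hJ : IsFracLeftIdeal A J)
    (h : I ⊆ J) : vClosure I ⊆ vClosure J :=
  fun _ hq => (hJ.mem_vcl hA).2 fun p hp => (hI.mem_vcl hA).1 hq p (hI.inv_anti hA hJ h hp)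

theorem vcl_subset (hA : IsMaximalOrder A) (hI : IsFracLeftIdeal A I) (hJ : IsFracLeftIdeal A J)
    (hJv : IsDivisorial J) (h : I ⊆ J) : vClosure I ⊆ J := by
  have := hI.vcl_mono hA hJ h
  rwa [show vClosure J = J from hJv] at this

theorem isDivisorial_vcl (hA : IsMaximalOrder A) (hI : IsFracLeftIdeal A I) :
    IsDivisorial (vClosure I) := by
  refine Set.Subset.antisymm ?_ ((hI.vcl hA).subset_vcl hA)
  intro q hq
  rw [(hI.vcl hA).mem_vcl hA] at hq
  refine (hI.mem_vcl hA).2 fun p hp => hq p ?_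
  exact ((hI.vcl hA).mem_inv hA).2 fun x hx => (hI.mem_vcl hA).1 hx p hp

theorem inter (hA : IsMaximalOrder A) (hI : IsFracLeftIdeal A I) (hJ : IsFracLeftIdeal A J) :
    IsFracLeftIdeal A (I ∩ J) := by
  obtain ⟨u, hu⟩ := hI.exists_unit
  obtain ⟨v, hv⟩ := hJ.exists_unit
  obtain ⟨w, hw⟩ := hI.exists_denom
  obtain ⟨a, ha, s, hs, e⟩ := hA.1.left ((u * v⁻¹ : Qˣ) : Q)
  have e' : (s : Q) * u = a * v := by
    have := congrArg (fun t => (s : Q) * t * v) e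
    simpa [mul_assoc] using this
  refine ⟨fun h hh x hx => ⟨hI.smul_mem h hh x hx.1, hJ.smul_mem h hh x hx.2⟩,
    ⟨s * u, hI.smul_mem _ hs _ hu, ?_⟩, ⟨w, fun x hx => hw x hx.1⟩⟩
  rw [Units.val_mul, e']
  exact hJ.smul_mem _ ha _ hv

theorem isDivisorial_inter (hA : IsMaximalOrder A) (hI : IsFracLeftIdeal A I)
    (hJ : IsFracLeftIdeal A J) (hIv : IsDivisorial I) (hJv : IsDivisorial J) :
    IsDivisorial (I ∩ J) :=
  Set.Subset.antisymm
    (Set.subset_inter ((hI.inter hA hJ).vcl_subset hA hI hIv Set.inter_subset_left)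
      ((hI.inter hA hJ).vcl_subset hA hJ hJv Set.inter_subset_right))
    ((hI.inter hA hJ).subset_vcl hA)

theorem union (hA : IsMaximalOrder A) (hI : IsFracLeftIdeal A I) (hJ : IsFracLeftIdeal A J) :
    IsFracLeftIdeal A (I ∪ J) := by
  obtain ⟨u, hu⟩ := hI.exists_unit
  obtain ⟨w, hw⟩ := hI.exists_denom
  obtain ⟨z, hz⟩ := hJ.exists_denom
  obtain ⟨a, ha, s, hs, e⟩ := hA.1.right ((w⁻¹ * z : Qˣ) : Q)
  have e' : (z : Q) * s = w * a := by
    have := congrArg (fun t => (w : Q) * t * s) e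
    simpa [mul_assoc] using this
  refine ⟨fun h hh x hx => hx.imp (hI.smul_mem h hh x) (hJ.smul_mem h hh x), ⟨u, Or.inl hu⟩,
    ⟨z * s, ?_⟩⟩
  rintro x (hx | hx)
  · rw [Units.val_mul, e', ← mul_assoc]
    exact A.mul_mem (hw x hx) ha
  · rw [Units.val_mul, ← mul_assoc]
    exact A.mul_mem (hz x hx) hs

/-- If `B' ⊇ O_r(I)` is an equivalent order, then `A ∪ I B' I⁻¹` is an order containing `A` and
equivalent to it, so that `I B' I⁻¹ ⊆ A`. Since `I` is divisorial, this means `I B' ⊆ I`. -/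
theorem isMaximalOrder_rightOrder (hA : IsMaximalOrder A) (hI : IsFracLeftIdeal A I)
    (hIv : IsDivisorial I) : IsMaximalOrder (rightOrder I) ∧ OrderEquiv A (rightOrder I) := by
  obtain ⟨u, hu⟩ := hI.exists_unit
  obtain ⟨w, hw⟩ := hI.exists_denom
  have hmem : ∀ a ∈ A, (w : Q) * a * u ∈ rightOrder I := by
    intro a ha x hx
    have := hI.smul_mem _ (A.mul_mem (hw x hx) ha) _ hu
    simpa [mul_assoc] using this
  have hAB : OrderEquiv A (rightOrder I) := by
    refine ⟨⟨w, u, hmem⟩, ⟨u, w, fun b hb => hw _ (hb _ hu)⟩⟩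
  refine ⟨⟨⟨fun q => ?_, fun q => ?_⟩, ?_⟩, hAB⟩
  · obtain ⟨a, ha, s, hs, e⟩ := hA.1.right ((w⁻¹ : Qˣ) * q * w)
    refine ⟨w * a * u, hmem a ha, w * s * u, hmem s hs, ?_⟩
    have := congrArg (fun t => (w : Q) * t * (w⁻¹ : Qˣ)) e
    simpa [mul_assoc] using this
  · obtain ⟨a, ha, s, hs, e⟩ := hA.1.left (u * q * (u⁻¹ : Qˣ))
    refine ⟨w * a * u, hmem a ha, w * s * u, hmem s hs, ?_⟩
    have := congrArg (fun t => ((u⁻¹ : Qˣ) : Q) * t * u) e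
    simpa [mul_assoc] using this
  · rintro B' - ⟨-, ⟨c, d, hcd⟩⟩ hle
    refine le_antisymm ?_ hle
    have hinv : ∀ p ∈ fracInv I, ∀ x ∈ I, p * x ∈ B' := by
      intro p hp x hx
      apply hle
      intro y hy
      rw [← mul_assoc]
      exact hI.smul_mem _ ((hI.mem_inv hA).1 hp y hy) _ hx
    let T : Submonoid Q :=
      { carrier := {t | t ∈ A ∨ ∃ x ∈ I, ∃ b ∈ B', ∃ p ∈ fracInv I, t = x * b * p}
        one_mem' := Or.inl A.one_mem
        mul_mem' := by
          rintro s t (hs | ⟨x, hx, b, hb, p, hp, rfl⟩) (ht | ⟨y, hy, b', hb', p', hp', rfl⟩)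
          · exact Or.inl (A.mul_mem hs ht)
          · exact Or.inr ⟨s * y, hI.smul_mem _ hs _ hy, b', hb', p', hp', by simp [mul_assoc]⟩
          · exact Or.inr ⟨x, hx, b, hb, p * t, (hI.inv hA).mul_mem _ ht _ hp, by simp [mul_assoc]⟩
          · exact Or.inr ⟨x, hx, b * (p * y) * b',
              B'.mul_mem (B'.mul_mem hb (hinv p hp y hy)) hb', p', hp', by simp [mul_assoc]⟩ }
    have hAT : A ≤ T := fun a ha => Or.inl ha
    have hTl : ∀ t ∈ T, ∀ x ∈ I, t * x ∈ I ∨ ∃ y ∈ I, ∃ b ∈ B', t * x = y * b := by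
      rintro t (ht | ⟨y, hy, b, hb, p, hp, rfl⟩) x hx
      · exact Or.inl (hI.smul_mem _ ht _ hx)
      · exact Or.inr ⟨y, hy, b * (p * x), B'.mul_mem hb (hinv p hp x hx), by simp [mul_assoc]⟩
    have hT : T = A := by
      refine hA.2 T (hA.1.of_le hAT) ⟨⟨1, 1, fun h hh => by simpa using hAT hh⟩, ?_⟩ hAT
      -- with `w ∈ I⁻¹` and `u ∈ I` one has `w T u ⊆ I⁻¹ I B' ⊆ B'`
      refine ⟨u * (c * w), u * d * w, fun t ht => ?_⟩
      have h1 : (w : Q) * t * u ∈ B' := by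
        rw [mul_assoc]
        have hwI := (hI.mem_inv hA).2 hw
        rcases hTl t ht u hu with h | ⟨y, hy, b, hb, h⟩
        · exact hinv _ hwI _ h
        · rw [h, ← mul_assoc]
          exact B'.mul_mem (hinv _ hwI _ hy) hb
      have := hw _ (hcd _ h1 u hu)
      simpa [mul_assoc] using this
    intro b hb x hx
    have hv : vClosure I = I := hIv
    rw [← hv, hI.mem_vcl hA]
    intro p hp
    rw [← hT]
    exact Or.inr ⟨x, hx, b, hb, p, hp, rfl⟩

end IsFracLeftIdeal

end OneSided

theorem OrderEquiv.trans {Q : Type*} [Monoid Q] {A B C : Submonoid Q} (h : OrderEquiv A B)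
    (h' : OrderEquiv B C) : OrderEquiv A C := by
  obtain ⟨⟨a, b, hab⟩, ⟨c, d, hcd⟩⟩ := h
  obtain ⟨⟨a', b', hab'⟩, ⟨c', d', hcd'⟩⟩ := h'
  refine ⟨⟨a' * a, b * b', fun x hx => ?_⟩, ⟨c * c', d' * d, fun x hx => ?_⟩⟩
  · simpa [mul_assoc] using hab' _ (hab x hx)
  · simpa [mul_assoc] using hcd _ (hcd' x hx)

theorem OrderEquiv.symm {Q : Type*} [Monoid Q] {A B : Submonoid Q} (h : OrderEquiv A B) :
    OrderEquiv B A := ⟨h.2, h.1⟩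

/-! ### The lattice of divisorial fractional left ideals -/

section Lattice

variable {Q : Type*} [Monoid Q] {H : Submonoid Q}

/-- The divisorial fractional left `A`-ideals, for `A ∈ α`. They are the elements of `F_v(α)` with
left order `A`. -/
def DivLeftIdeal (A : MaximalOrderClass H) : Type _ :=
  {I : Set Q // IsFracLeftIdeal A.order I ∧ IsDivisorial I}

namespace DivLeftIdeal

variable {A B C : MaximalOrderClass H}

instance : SetLike (DivLeftIdeal A) Q := ⟨Subtype.val, Subtype.val_injective⟩

@[ext] theorem ext {x y : DivLeftIdeal A} (h : ∀ p, p ∈ x ↔ p ∈ y) : x = y := SetLike.ext h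

theorem isFrac (x : DivLeftIdeal A) : IsFracLeftIdeal A.order (x : Set Q) := x.2.1

theorem isDivisorial (x : DivLeftIdeal A) : IsDivisorial (x : Set Q) := x.2.2

instance : Lattice (DivLeftIdeal A) where
  le x y := (x : Set Q) ⊆ y
  le_refl x := Set.Subset.rfl
  le_trans x y z h h' := Set.Subset.trans h h'
  le_antisymm x y h h' := Subtype.ext (Set.Subset.antisymm h h')
  inf x y := ⟨x ∩ y, x.isFrac.inter A.isMaximalOrder y.isFrac,
    x.isFrac.isDivisorial_inter A.isMaximalOrder y.isFrac x.isDivisorial y.isDivisorial⟩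
  inf_le_left x y := Set.inter_subset_left
  inf_le_right x y := Set.inter_subset_right
  le_inf x y z h h' := Set.subset_inter h h'
  sup x y := ⟨vClosure (x ∪ y), (x.isFrac.union A.isMaximalOrder y.isFrac).vcl A.isMaximalOrder,
    (x.isFrac.union A.isMaximalOrder y.isFrac).isDivisorial_vcl A.isMaximalOrder⟩
  le_sup_left x y := Set.subset_union_left.trans
    ((x.isFrac.union A.isMaximalOrder y.isFrac).subset_vcl A.isMaximalOrder)
  le_sup_right x y := Set.subset_union_right.trans
    ((x.isFrac.union A.isMaximalOrder y.isFrac).subset_vcl A.isMaximalOrder)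
  sup_le x y z h h' := (x.isFrac.union A.isMaximalOrder y.isFrac).vcl_subset A.isMaximalOrder
    z.isFrac z.isDivisorial (Set.union_subset h h')

/-- An element of `F_v(α)` as a left ideal over its left order. -/
def ofHom (u : A ⟶ B) : DivLeftIdeal A := ⟨idealSet u, (DivisorialHom.isFracBiIdeal u).1, u.mem.1⟩

@[simp] theorem coe_ofHom (u : A ⟶ B) : (ofHom u : Set Q) = idealSet u := rfl

theorem exists_hom (x : DivLeftIdeal A) : ∃ (B : MaximalOrderClass H) (u : A ⟶ B), ofHom u = x := by
  have h := x.isFrac.isMaximalOrder_rightOrder A.isMaximalOrder x.isDivisorial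
  exact ⟨⟨rightOrder (x : Set Q), h.1, A.equiv.trans h.2⟩,
    ⟨x, ⟨x.isDivisorial, A, Or.inl x.isFrac⟩, leftOrder_eq A.isMaximalOrder x.isFrac, rfl⟩, rfl⟩

theorem ofHom_injective : Function.Injective (ofHom : (A ⟶ B) → DivLeftIdeal A) :=
  fun _ _ h => DivisorialHom.ext (congrArg Subtype.val h)

/-- The order `A` itself. -/
def unit (A : MaximalOrderClass H) : DivLeftIdeal A := ofHom (𝟙 A)

end DivLeftIdeal

/-! ### Inclusions between elements of `F_v(α)` -/

variable {A B C D : MaximalOrderClass H}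

theorem idealSet_isFrac (u : A ⟶ B) : IsFracBiIdeal A.order B.order (idealSet u) :=
  DivisorialHom.isFracBiIdeal u

theorem idealSet_isDivisorial (u : A ⟶ B) : IsDivisorial (idealSet u) := u.mem.1

theorem mul_subset_idealSet_comp (u : A ⟶ B) (v : B ⟶ C) :
    idealSet u * idealSet v ⊆ idealSet (u ≫ v) :=
  ((idealSet_isFrac u).mul (idealSet_isFrac v)).subset_vcl A.isMaximalOrder C.isMaximalOrder

theorem idealSet_comp_subset (u : A ⟶ B) (v : B ⟶ C) (w : A ⟶ D) :
    idealSet (u ≫ v) ⊆ idealSet w ↔ ∀ p ∈ idealSet u, ∀ z ∈ idealSet v, p * z ∈ idealSet w := by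
  constructor
  · intro h p hp z hz
    exact h (mul_subset_idealSet_comp u v (Set.mul_mem_mul hp hz))
  · intro h
    refine ((idealSet_isFrac u).mul (idealSet_isFrac v)).1.vcl_subset A.isMaximalOrder
      (idealSet_isFrac w).1 (idealSet_isDivisorial w) ?_
    rintro _ ⟨p, hp, z, hz, rfl⟩
    exact h p hp z hz

theorem comp_subset_comp_left (k : A ⟶ B) {u : B ⟶ C} {v : B ⟶ D} (h : idealSet u ⊆ idealSet v) :
    idealSet (k ≫ u) ⊆ idealSet (k ≫ v) :=
  (idealSet_comp_subset k u _).2 fun _ hp _ hz =>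
    mul_subset_idealSet_comp k v (Set.mul_mem_mul hp (h hz))

theorem comp_subset_comp_left_iff (k : A ⟶ B) {u : B ⟶ C} {v : B ⟶ D} :
    idealSet (k ≫ u) ⊆ idealSet (k ≫ v) ↔ idealSet u ⊆ idealSet v := by
  refine ⟨fun h => ?_, comp_subset_comp_left k⟩
  simpa using comp_subset_comp_left (Groupoid.inv k) h

/-- An element of `F_v(α)` is contained in its left order if and only if it is contained in its
right order. -/
theorem subset_left_iff_subset_right (u : A ⟶ B) :
    idealSet u ⊆ A.order ↔ idealSet u ⊆ B.order := by
  have hl := DivisorialHom.leftOrder_eq u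
  have hr := DivisorialHom.rightOrder_eq u
  constructor
  · intro h x hx
    rw [← hr]
    intro y hy
    have h' := h hy
    rw [← hl] at h'
    exact h' x hx
  · intro h x hx
    rw [← hl]
    intro y hy
    have h' := h hy
    rw [← hr] at h'
    exact h' x hx

theorem vClosure_subset_right {I : Set Q} (hI : IsFracBiIdeal A.order C.order I) (w : D ⟶ C)
    (h : I ⊆ idealSet w) : vClosure I ⊆ idealSet w := by
  intro q hq
  have hw := idealSet_isFrac w
  rw [← show vClosure (idealSet w) = idealSet w from idealSet_isDivisorial w]
  refine ((hw.inv D.isMaximalOrder C.isMaximalOrder).mem_inv_left C.isMaximalOrder).2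
    fun p hp => ?_
  exact ((hI.inv A.isMaximalOrder C.isMaximalOrder).mem_inv_left C.isMaximalOrder).1 hq p
    ((hI.mem_inv_right C.isMaximalOrder).2 fun x hx =>
      (hw.mem_inv_right C.isMaximalOrder).1 hp _ (h hx))

theorem idealSet_comp_subset_right (u : A ⟶ B) (v : B ⟶ C) (w : D ⟶ C) :
    idealSet (u ≫ v) ⊆ idealSet w ↔ ∀ p ∈ idealSet u, ∀ z ∈ idealSet v, p * z ∈ idealSet w := by
  constructor
  · intro h p hp z hz
    exact h (mul_subset_idealSet_comp u v (Set.mul_mem_mul hp hz))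
  · intro h
    refine vClosure_subset_right ((idealSet_isFrac u).mul (idealSet_isFrac v)) w ?_
    rintro _ ⟨p, hp, z, hz, rfl⟩
    exact h p hp z hz

theorem comp_subset_comp_right {u : A ⟶ B} {v : D ⟶ B} (k : B ⟶ C)
    (h : idealSet u ⊆ idealSet v) : idealSet (u ≫ k) ⊆ idealSet (v ≫ k) :=
  (idealSet_comp_subset_right u k _).2 fun _ hp _ hz =>
    mul_subset_idealSet_comp v k (Set.mul_mem_mul (h hp) hz)

theorem comp_subset_comp_right_iff {u : A ⟶ B} {v : D ⟶ B} (k : B ⟶ C) :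
    idealSet (u ≫ k) ⊆ idealSet (v ≫ k) ↔ idealSet u ⊆ idealSet v := by
  refine ⟨fun h => ?_, comp_subset_comp_right k⟩
  simpa using comp_subset_comp_right (Groupoid.inv k) h

theorem comp_subset_left (u : A ⟶ B) {x : B ⟶ C} (hx : idealSet x ⊆ B.order) :
    idealSet (u ≫ x) ⊆ idealSet u := by
  simpa using comp_subset_comp_left u (v := 𝟙 B) hx

theorem comp_subset_right {x : A ⟶ B} (hx : idealSet x ⊆ A.order) (u : B ⟶ C) :
    idealSet (x ≫ u) ⊆ idealSet u := by
  simpa using comp_subset_comp_right u (v := 𝟙 B) ((subset_left_iff_subset_right x).1 hx)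

/-- The groupoid `F_v(α)` is connected: if `a A b ⊆ B`, then `A b B` is a fractional right
`B`-ideal, and its left order is `A` because `A` is maximal. -/
theorem nonempty_hom (A B : MaximalOrderClass H) : Nonempty (A ⟶ B) := by
  obtain ⟨⟨a, b, hab⟩, ⟨c, d, hcd⟩⟩ := A.equiv.symm.trans B.equiv
  let I : Set Q := {x | ∃ y ∈ A.order, ∃ z ∈ B.order, x = y * b * z}
  have hb : (b : Q) ∈ I := ⟨1, A.order.one_mem, 1, B.order.one_mem, by simp⟩
  have hI : IsFracRightIdeal B.order I := by
    refine ⟨?_, ⟨b, hb⟩, ⟨a, ?_⟩⟩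
    · rintro h hh _ ⟨y, hy, z, hz, rfl⟩
      exact ⟨y, hy, z * h, B.order.mul_mem hz hh, by simp [mul_assoc]⟩
    · rintro _ ⟨y, hy, z, hz, rfl⟩
      have := B.order.mul_mem (hab y hy) hz
      simpa [mul_assoc] using this
  have hle : A.order ≤ leftOrder I := by
    rintro h hh _ ⟨y, hy, z, hz, rfl⟩
    exact ⟨h * y, A.order.mul_mem hh hy, z, hz, by simp [mul_assoc]⟩
  have hl : leftOrder I = A.order := by
    refine A.isMaximalOrder.2 _ (A.isMaximalOrder.1.of_le hle)
      ⟨⟨1, 1, fun h hh => by simpa using hle hh⟩, ⟨c * a, b * d, ?_⟩⟩ hle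
    intro x hx
    obtain ⟨y, hy, z, hz, e⟩ := hx _ hb
    have := hcd _ (B.order.mul_mem (hab y hy) hz)
    have e' : (a : Q) * y * b * z = a * (x * b) := by rw [e]; simp [mul_assoc]
    rw [e'] at this
    simpa [mul_assoc] using this
  have hbi : IsFracBiIdeal A.order B.order I := by
    refine ⟨⟨fun h hh => by rw [← hl] at hh; exact hh, ⟨b, hb⟩, ⟨a, fun x hx => ?_⟩⟩, hI⟩
    -- `I a I ⊆ I B ⊆ I`
    rw [SetLike.mem_coe, ← hl]
    rintro _ ⟨y, hy, z, hz, rfl⟩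
    have := hI.mul_mem _ (B.order.mul_mem (hab y hy) hz) x hx
    simpa [mul_assoc] using this
  exact ⟨(hbi.vcl A.isMaximalOrder B.isMaximalOrder).toHom
    (congrArg fracInv (hbi.inv_vcl A.isMaximalOrder B.isMaximalOrder))⟩

end Lattice

/-! ### Labelled maximal chains in modular lattices -/

section Chains

variable {L T : Type*} [Lattice L]

/-- `LabelledChain φ x z m`: there is a maximal chain from `x` to `z`, and `m` is the multiset of
the labels `φ a b` of its steps `a ⋖ b`. -/
inductive LabelledChain (φ : L → L → T) : L → L → Multiset T → Prop
  | refl (x : L) : LabelledChain φ x x 0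
  | step {x y z : L} {m : Multiset T} (h : x ⋖ y) (c : LabelledChain φ y z m) :
      LabelledChain φ x z (φ x y ::ₘ m)

namespace LabelledChain

variable {φ : L → L → T} {x y z : L} {m n : Multiset T}

theorem le (h : LabelledChain φ x z m) : x ≤ z := by
  induction h with
  | refl => exact le_rfl
  | step h _ ih => exact h.le.trans ih

theorem trans (h : LabelledChain φ x y m) (h' : LabelledChain φ y z n) :
    LabelledChain φ x z (m + n) := by
  induction h with
  | refl => simpa using h'
  | step h _ ih => simpa using step h (ih h')

theorem single (h : x ⋖ y) : LabelledChain φ x y {φ x y} := step h (refl y)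

theorem eq_of_self (h : LabelledChain φ x x m) : m = 0 := by
  cases h with
  | refl => rfl
  | step h c => exact absurd c.le (not_le_of_gt h.lt)

theorem eq_of_zero (h : LabelledChain φ x z 0) : x = z := by
  generalize hm : (0 : Multiset T) = m at h
  cases h with
  | refl => rfl
  | step h c => simp at hm

theorem map {L' : Type*} [Lattice L'] {φ' : L' → L' → T} (f : L ≃o L')
    (hf : ∀ a b, φ' (f a) (f b) = φ a b) (h : LabelledChain φ x z m) :
    LabelledChain φ' (f x) (f z) m := by
  induction h with
  | refl => exact refl _
  | @step x y z m h _ ih =>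
    rw [← hf]
    exact step ((apply_covBy_apply_iff f).2 h) ih

end LabelledChain

/-- Below every element the ascending chain condition holds, and above every element the descending
one, so that all intervals satisfy both. -/
class LocallyFiniteLength (L : Type*) [Lattice L] : Prop where
  wellFounded_gt : ∀ z : L, WellFounded fun a b : Set.Iic z => a > b
  wellFounded_lt : ∀ x : L, WellFounded fun a b : Set.Ici x => a < b

theorem exists_le_covBy [LocallyFiniteLength L] {x y : L} (h : x < y) : ∃ a, x ≤ a ∧ a ⋖ y := by
  obtain ⟨⟨a, hay⟩, ⟨hxa, hlt⟩, hmax⟩ := (LocallyFiniteLength.wellFounded_gt y).has_min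
    {t : Set.Iic y | x ≤ t ∧ (t : L) < y} ⟨⟨x, h.le⟩, le_rfl, h⟩
  refine ⟨a, hxa, hlt, fun b hab hby => ?_⟩
  exact hmax ⟨b, hby.le⟩ ⟨hxa.trans hab.le, hby⟩ hab

theorem exists_labelledChain [LocallyFiniteLength L] (φ : L → L → T) {x z : L} (h : x ≤ z) :
    ∃ m, LabelledChain φ x z m := by
  obtain ⟨⟨y, hxy⟩, ⟨m, hm⟩, hmin⟩ := (LocallyFiniteLength.wellFounded_lt x).has_min
    {t : Set.Ici x | ∃ m, LabelledChain φ t z m} ⟨⟨z, h⟩, 0, LabelledChain.refl z⟩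
  rcases (show x ≤ y from hxy).eq_or_lt with rfl | hlt
  · exact ⟨m, hm⟩
  · obtain ⟨a, hxa, hay⟩ := exists_le_covBy hlt
    exact absurd hay.lt (hmin ⟨a, hxa⟩ ⟨_, LabelledChain.step hay hm⟩)

/-- The Jordan–Hölder theorem, for labels that agree on perspective steps `x ⋖ x ⊔ y` and
`x ⊓ y ⋖ y`. -/
theorem LabelledChain.unique [IsModularLattice L] [LocallyFiniteLength L] {φ : L → L → T}
    (hφ : ∀ x y, φ x (x ⊔ y) = φ (x ⊓ y) y) {x z : L} {m m' : Multiset T}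
    (h : LabelledChain φ x z m) (h' : LabelledChain φ x z m') : m = m' := by
  induction hn : Multiset.card m generalizing x m m' with
  | zero =>
    obtain rfl := Multiset.card_eq_zero.1 hn
    obtain rfl := h.eq_of_zero
    exact h'.eq_of_self.symm
  | succ k ih =>
    cases h with
    | refl => simp at hn
    | @step _ y _ m hxy c =>
      cases h' with
      | refl => exact absurd c.le (not_le_of_gt hxy.lt)
      | @step _ y' _ m' hxy' c' =>
        have hm : Multiset.card m = k := by simpa using hn
        by_cases hyy : y = y'
        · subst hyy
          rw [ih c c' hm]
        -- compare both chains with chains through `y ⊔ y'`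
        · have hinf : y ⊓ y' = x := by
            rcases hxy.eq_or_eq (le_inf hxy.le hxy'.le) inf_le_left with e | e
            · exact e
            · exact absurd ((hxy'.eq_or_eq hxy.le (inf_eq_left.1 e)).resolve_left hxy.ne') hyy
          have hy : y ⋖ y ⊔ y' := covBy_sup_of_inf_covBy_right (by rwa [hinf])
          have hy' : y' ⋖ y ⊔ y' := covBy_sup_of_inf_covBy_left (by rwa [hinf])
          obtain ⟨n, hn'⟩ := exists_labelledChain φ (sup_le c.le c'.le)
          have e1 := ih c (step hy hn') hm
          have hcard : Multiset.card (φ y' (y ⊔ y') ::ₘ n) = k := by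
            rw [← hm, e1, Multiset.card_cons, Multiset.card_cons]
          have e2 := ih (step hy' hn') c' hcard
          have p1 : φ y (y ⊔ y') = φ x y' := by rw [hφ, hinf]
          have p2 : φ y' (y ⊔ y') = φ x y := by rw [sup_comm, hφ, inf_comm, hinf]
          rw [e1, ← e2, p1, p2, Multiset.cons_swap]

/-- The multiset of labels of a maximal chain from `x` to `z`, for `x ≤ z` (and a junk value
otherwise). -/
noncomputable def chainLabels (φ : L → L → T) (x z : L) : Multiset T :=
  Classical.epsilon fun m => LabelledChain φ x z m

section

variable [LocallyFiniteLength L] {φ : L → L → T} {x y z : L}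

theorem labelledChain_chainLabels (φ : L → L → T) (h : x ≤ z) :
    LabelledChain φ x z (chainLabels φ x z) :=
  Classical.epsilon_spec (exists_labelledChain φ h)

theorem chainLabels_self : chainLabels φ x x = 0 :=
  (labelledChain_chainLabels φ le_rfl).eq_of_self

theorem eq_of_chainLabels_eq_zero (hxz : x ≤ z) (h : chainLabels φ x z = 0) : x = z :=
  (h ▸ labelledChain_chainLabels φ hxz).eq_of_zero

variable [IsModularLattice L] (hφ : ∀ x y, φ x (x ⊔ y) = φ (x ⊓ y) y)
include hφ

theorem LabelledChain.eq_chainLabels {m : Multiset T} (h : LabelledChain φ x z m) :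
    m = chainLabels φ x z :=
  h.unique hφ (labelledChain_chainLabels φ h.le)

theorem chainLabels_add (h : x ≤ y) (h' : y ≤ z) :
    chainLabels φ x y + chainLabels φ y z = chainLabels φ x z :=
  ((labelledChain_chainLabels φ h).trans (labelledChain_chainLabels φ h')).eq_chainLabels hφ

theorem chainLabels_covBy (h : x ⋖ y) : chainLabels φ x y = {φ x y} :=
  ((LabelledChain.single h).eq_chainLabels hφ).symm

end

theorem chainLabels_map [LocallyFiniteLength L] {L' : Type*} [Lattice L'] [LocallyFiniteLength L']
    [IsModularLattice L'] {φ : L → L → T} {φ' : L' → L' → T}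
    (hφ' : ∀ x y, φ' x (x ⊔ y) = φ' (x ⊓ y) y) (f : L ≃o L')
    (hf : ∀ a b, φ' (f a) (f b) = φ a b) {x z : L} (h : x ≤ z) :
    chainLabels φ' (f x) (f z) = chainLabels φ x z :=
  (((labelledChain_chainLabels φ h).map f hf).eq_chainLabels hφ').symm

/-- The product of the labels from `x ⊓ y` up to `y`, divided by that of the labels from `x ⊓ y` up
to `x`. Any other common lower bound gives the same value (`relNorm_eq`), which makes `relNorm`
a cocycle (`relNorm_mul`). -/
noncomputable def relNorm [CommGroup T] (φ : L → L → T) (x y : L) : T :=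
  (chainLabels φ (x ⊓ y) y).prod / (chainLabels φ (x ⊓ y) x).prod

section

variable [CommGroup T] [LocallyFiniteLength L] [IsModularLattice L] {φ : L → L → T} {x y z m : L}
  (hφ : ∀ x y, φ x (x ⊔ y) = φ (x ⊓ y) y)
include hφ

theorem relNorm_eq (hx : m ≤ x) (hy : m ≤ y) :
    relNorm φ x y = (chainLabels φ m y).prod / (chainLabels φ m x).prod := by
  rw [relNorm, ← chainLabels_add hφ (le_inf hx hy) inf_le_right,
    ← chainLabels_add hφ (le_inf hx hy) inf_le_left, Multiset.prod_add, Multiset.prod_add,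
    mul_div_mul_left_eq_div]

theorem relNorm_of_le (h : x ≤ y) : relNorm φ x y = (chainLabels φ x y).prod := by
  rw [relNorm_eq hφ le_rfl h, chainLabels_self, Multiset.prod_zero, div_one]

theorem relNorm_mul : relNorm φ x y * relNorm φ y z = relNorm φ x z := by
  have h1 : x ⊓ y ⊓ z ≤ x := inf_le_left.trans inf_le_left
  have h2 : x ⊓ y ⊓ z ≤ y := inf_le_left.trans inf_le_right
  rw [relNorm_eq hφ h1 h2, relNorm_eq hφ h2 inf_le_right, relNorm_eq hφ h1 inf_le_right]
  simp [div_eq_mul_inv, mul_comm]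

omit hφ [IsModularLattice L] in
theorem relNorm_map {L' : Type*} [Lattice L'] [LocallyFiniteLength L'] [IsModularLattice L']
    {φ' : L' → L' → T} (hφ' : ∀ x y, φ' x (x ⊔ y) = φ' (x ⊓ y) y) (f : L ≃o L')
    (hf : ∀ a b, φ' (f a) (f b) = φ a b) : relNorm φ' (f x) (f y) = relNorm φ x y := by
  rw [relNorm, ← map_inf, chainLabels_map hφ' f hf inf_le_right,
    chainLabels_map hφ' f hf inf_le_left, relNorm]

end

end Chains

/-! ### Partially ordered groups with ascending chain condition -/

section OrderedGroups

variable {G : Type*} [Group G] [PartialOrder G]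

theorem exists_le_covBy_one (hwf : WellFounded fun a b : Set.Iic (1 : G) => a > b) {x : G}
    (h : x < 1) : ∃ p : G, x ≤ p ∧ p ⋖ 1 := by
  obtain ⟨⟨a, ha⟩, ⟨hxa, hlt⟩, hmax⟩ := hwf.has_min
    {t : Set.Iic (1 : G) | x ≤ t ∧ (t : G) < 1} ⟨⟨x, h.le⟩, le_rfl, h⟩
  refine ⟨a, hxa, hlt, fun b hab hby => ?_⟩
  exact hmax ⟨b, hby.le⟩ ⟨hxa.trans hab.le, hby⟩ hab

variable [MulLeftMono G] [MulRightMono G]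

theorem mem_closure_covBy_one (hwf : WellFounded fun a b : Set.Iic (1 : G) => a > b) {x : G}
    (h : x ≤ 1) : x ∈ Submonoid.closure {p : G | p ⋖ 1} := by
  suffices ∀ x : Set.Iic (1 : G), (x : G) ∈ Submonoid.closure {p : G | p ⋖ 1} from this ⟨x, h⟩
  intro x
  induction x using hwf.induction with
  | _ x ih =>
    obtain ⟨x, hx⟩ := x
    rcases (show x ≤ 1 from hx).eq_or_lt with rfl | hlt
    · exact Submonoid.one_mem _
    · obtain ⟨p, hxp, hp⟩ := exists_le_covBy_one hwf hlt
      have h1 : p⁻¹ * x ≤ 1 := by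
        have := mul_le_mul_right hxp p⁻¹
        rwa [inv_mul_cancel] at this
      have h2 : x < p⁻¹ * x := by
        refine lt_of_le_of_ne (le_mul_of_one_le_left' (one_le_inv'.2 hp.le)) fun e => hp.lt.ne ?_
        have e' : 1 * x = p⁻¹ * x := by rw [one_mul, ← e]
        simpa using (mul_right_cancel e').symm
      have hp' : p ∈ {p : G | p ⋖ 1} := hp
      have := mul_mem (Submonoid.subset_closure hp') (ih ⟨p⁻¹ * x, h1⟩ h2)
      rwa [mul_inv_cancel_left] at this

omit [MulRightMono G] in
theorem le_one_of_mem_closure {x : G} (hx : x ∈ Submonoid.closure {p : G | p ⋖ 1}) : x ≤ 1 := by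
  induction hx using Submonoid.closure_induction with
  | mem p hp => exact hp.le
  | one => exact le_rfl
  | mul a b _ _ ha hb => exact mul_le_one' ha hb

/-- Coprime elements `p`, `q` commute, because `p ⊓ q = p q`. -/
theorem mul_comm_of_covBy_one (hinf : ∀ x y : G, ∃ z, IsGLB {x, y} z) {p q : G} (hp : p ⋖ 1)
    (hq : q ⋖ 1) : p * q = q * p := by
  by_cases hpq : p = q
  · rw [hpq]
  have hsup : ∀ w, p ≤ w → q ≤ w → 1 ≤ w := by
    intro w hpw hqw
    obtain ⟨s, hs⟩ := hinf w 1
    have hsw : s ≤ w := hs.1 (by simp)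
    have hs1 : s ≤ 1 := hs.1 (by simp)
    have hps : p ≤ s := hs.2 (by simp [lowerBounds, hpw, hp.le])
    have hqs : q ≤ s := hs.2 (by simp [lowerBounds, hqw, hq.le])
    rcases hp.eq_or_eq hps hs1 with e | e
    · rw [e] at hqs
      rcases hq.eq_or_eq hqs hp.le with e' | e'
      · exact absurd e' hpq
      · exact absurd e' hp.lt.ne
    · rwa [e] at hsw
  have key : ∀ p q r : G, p ≤ 1 → q ≤ 1 → IsGLB {p, q} r →
      (∀ w, p ≤ w → q ≤ w → 1 ≤ w) → r = p * q := by
    intro p q r hp hq hr hsup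
    have hrp : r ≤ p := hr.1 (by simp)
    have hrq : r ≤ q := hr.1 (by simp)
    apply le_antisymm
    · have h := hsup (q * r⁻¹ * p) ?_ ?_
      · have := mul_le_mul_left (mul_le_mul_right h q⁻¹) p⁻¹
        rw [← inv_le_inv_iff]
        simpa [mul_assoc] using this
      · refine le_mul_of_one_le_left' ?_
        simpa using mul_le_mul_left hrq r⁻¹
      · rw [mul_assoc]
        refine le_mul_of_one_le_right' ?_
        simpa using mul_le_mul_right hrp r⁻¹
    · exact hr.2 (by simp [lowerBounds, hp, hq])
  obtain ⟨r, hr⟩ := hinf p q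
  rw [← key p q r hp.le hq.le hr hsup]
  exact key q p r hq.le hp.le (by rwa [Set.pair_comm]) fun w h h' => hsup w h' h

/-- A group with compatible order, binary infima and the ascending chain condition on elements
`≤ 1` is commutative. -/
theorem mul_comm_of_wellFounded (hwf : WellFounded fun a b : Set.Iic (1 : G) => a > b)
    (hinf : ∀ x y : G, ∃ z, IsGLB {x, y} z) (x y : G) : x * y = y * x := by
  have hle : ∀ x y : G, x ≤ 1 → y ≤ 1 → Commute x y := by
    intro x y hx hy
    have hp : ∀ p : G, p ⋖ 1 → Commute x p := by
      intro p hp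
      induction mem_closure_covBy_one hwf hx using Submonoid.closure_induction with
      | mem q hq => exact mul_comm_of_covBy_one hinf hq hp
      | one => exact Commute.one_left p
      | mul a b ha' hb' ha hb => exact (ha (le_one_of_mem_closure ha')).mul_left (hb (le_one_of_mem_closure hb'))
    induction mem_closure_covBy_one hwf hy using Submonoid.closure_induction with
    | mem q hq => exact hp q hq
    | one => exact Commute.one_right x
    | mul a b ha' hb' ha hb => exact (ha (le_one_of_mem_closure ha')).mul_right (hb (le_one_of_mem_closure hb'))
  have hex : ∀ x : G, ∃ z, z ≤ 1 ∧ x * z ≤ 1 := by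
    intro x
    obtain ⟨z, hz⟩ := hinf x⁻¹ 1
    refine ⟨z, hz.1 (by simp), ?_⟩
    have := mul_le_mul_right (hz.1 (by simp) : z ≤ x⁻¹) x
    rwa [mul_inv_cancel] at this
  obtain ⟨z, hz, hxz⟩ := hex x
  obtain ⟨t, ht, hyt⟩ := hex y
  have h1 : ∀ w, w ≤ 1 → Commute x w := by
    intro w hw
    have := (hle _ _ hxz hw).mul_left (hle _ _ hz hw).inv_left
    rwa [mul_inv_cancel_right] at this
  have := (h1 _ hyt).mul_right (h1 _ ht).inv_right
  rw [mul_inv_cancel_right] at this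
  exact this

end OrderedGroups

/-! ### Translations of divisorial left ideals -/

section Translations

variable {Q : Type*} [Monoid Q] {H : Submonoid Q} {A B C D : MaximalOrderClass H}

namespace DivLeftIdeal

theorem isFrac_mul (k : A ⟶ B) (x : DivLeftIdeal B) :
    IsFracLeftIdeal A.order (idealSet k * (x : Set Q)) := by
  obtain ⟨C, u, rfl⟩ := x.exists_hom
  exact ((idealSet_isFrac k).mul (idealSet_isFrac u)).1

/-- Multiplication from the left by an element of `F_v(α)`. -/
def smulFun (k : A ⟶ B) (x : DivLeftIdeal B) : DivLeftIdeal A :=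
  ⟨vClosure (idealSet k * (x : Set Q)), (isFrac_mul k x).vcl A.isMaximalOrder,
    (isFrac_mul k x).isDivisorial_vcl A.isMaximalOrder⟩

theorem smulFun_ofHom (k : A ⟶ B) (u : B ⟶ C) : smulFun k (ofHom u) = ofHom (k ≫ u) := rfl

theorem ofHom_le {u : A ⟶ B} {v : A ⟶ C} : ofHom u ≤ ofHom v ↔ idealSet u ⊆ idealSet v := Iff.rfl

/-- Multiplication from the left by an element of `F_v(α)`, as an isomorphism of lattices. -/
def smul (k : A ⟶ B) : DivLeftIdeal B ≃o DivLeftIdeal A where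
  toFun := smulFun k
  invFun := smulFun (Groupoid.inv k)
  left_inv x := by
    obtain ⟨C, u, rfl⟩ := x.exists_hom
    simp [smulFun_ofHom]
  right_inv x := by
    obtain ⟨C, u, rfl⟩ := x.exists_hom
    simp [smulFun_ofHom]
  map_rel_iff' {x y} := by
    obtain ⟨C, u, rfl⟩ := x.exists_hom
    obtain ⟨D, v, rfl⟩ := y.exists_hom
    exact comp_subset_comp_left_iff k

@[simp] theorem smul_ofHom (k : A ⟶ B) (u : B ⟶ C) : smul k (ofHom u) = ofHom (k ≫ u) := rfl

@[simp] theorem smul_unit (k : A ⟶ B) : smul k (unit B) = ofHom k := by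
  rw [unit, smul_ofHom, Category.comp_id]

/-- The ideal `x q`, for `q ∈ Q^•`, written as a preimage under multiplication by `q⁻¹`. -/
def rmulFun (q : Qˣ) (x : DivLeftIdeal A) : DivLeftIdeal A := by
  have hfrac : IsFracLeftIdeal A.order {p | p * ((q⁻¹ : Qˣ) : Q) ∈ (x : Set Q)} := by
    obtain ⟨u, hu⟩ := x.isFrac.exists_unit
    obtain ⟨w, hw⟩ := x.isFrac.exists_denom
    refine ⟨fun h hh p hp => ?_, ⟨u * q, by simpa using hu⟩, ⟨q⁻¹ * w, fun p hp => ?_⟩⟩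
    · have := x.isFrac.smul_mem h hh _ hp
      rwa [← mul_assoc] at this
    · have := hw _ hp
      rwa [mul_assoc] at this
  refine ⟨{p | p * ((q⁻¹ : Qˣ) : Q) ∈ (x : Set Q)}, hfrac,
    Set.Subset.antisymm (fun p hp => ?_) (hfrac.subset_vcl A.isMaximalOrder)⟩
  rw [hfrac.mem_vcl A.isMaximalOrder] at hp
  have hx : vClosure (x : Set Q) = x := x.isDivisorial
  rw [Set.mem_ofPred_eq, ← hx, x.isFrac.mem_vcl A.isMaximalOrder]
  intro s hs
  rw [mul_assoc]
  refine hp _ ((hfrac.mem_inv A.isMaximalOrder).2 fun t ht => ?_)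
  rw [← mul_assoc]
  exact (x.isFrac.mem_inv A.isMaximalOrder).1 hs _ ht

theorem mem_rmulFun {q : Qˣ} {x : DivLeftIdeal A} {p : Q} :
    p ∈ rmulFun q x ↔ p * ((q⁻¹ : Qˣ) : Q) ∈ x := Iff.rfl

/-- Multiplication from the right by an element of `Q^•`, as an isomorphism of lattices. -/
def rmul (A : MaximalOrderClass H) (q : Qˣ) : DivLeftIdeal A ≃o DivLeftIdeal A where
  toFun := rmulFun q
  invFun := rmulFun q⁻¹
  left_inv x := by
    ext p
    simp [mem_rmulFun]
  right_inv x := by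
    ext p
    simp [mem_rmulFun]
  map_rel_iff' {x y} := by
    refine ⟨fun h p hp => ?_, fun h p hp => h hp⟩
    have := @h (p * q) (by simpa [mem_rmulFun] using hp)
    simpa [mem_rmulFun] using this

theorem mem_rmul {q : Qˣ} {x : DivLeftIdeal A} {p : Q} :
    p ∈ rmul A q x ↔ p * ((q⁻¹ : Qˣ) : Q) ∈ x := Iff.rfl

theorem rmul_rmul (q r : Qˣ) (x : DivLeftIdeal A) : rmul A r (rmul A q x) = rmul A (q * r) x := by
  ext p
  simp [mem_rmul, mul_assoc]

theorem rmul_one (x : DivLeftIdeal A) : rmul A 1 x = x := by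
  ext p
  simp [mem_rmul]

theorem coe_rmul_unit (q : Qˣ) : (rmul A q (unit A) : Set Q) = (A.order : Set Q) * {(q : Q)} := by
  ext p
  rw [SetLike.mem_coe, mem_rmul, Set.mul_singleton]
  constructor
  · intro h
    exact ⟨_, h, by simp⟩
  · rintro ⟨t, ht, rfl⟩
    have : t ∈ unit A := ht
    simpa using this

end DivLeftIdeal

end Translations

/-! ### Chain conditions and modularity -/

section ChainConditions

theorem LocallyFiniteLength.of_orderIso {L L' : Type*} [Lattice L] [Lattice L'] [LocallyFiniteLength L']
    (f : L ≃o L') : LocallyFiniteLength L where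
  wellFounded_gt z := by
    refine Subrelation.wf (fun {a b} (h : a > b) => ?_)
      (InvImage.wf (fun a : Set.Iic z => (⟨f a, f.monotone a.2⟩ : Set.Iic (f z)))
        (LocallyFiniteLength.wellFounded_gt (f z)))
    exact f.strictMono h
  wellFounded_lt x := by
    refine Subrelation.wf (fun {a b} (h : a < b) => ?_)
      (InvImage.wf (fun a : Set.Ici x => (⟨f a, f.monotone a.2⟩ : Set.Ici (f x)))
        (LocallyFiniteLength.wellFounded_lt (f x)))
    exact f.strictMono h

theorem IsModularLattice.of_orderIso {L L' : Type*} [Lattice L] [Lattice L'] [IsModularLattice L']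
    (f : L ≃o L') : IsModularLattice L where
  sup_inf_le_assoc_of_le {x} y {z} h := by
    rw [← f.le_iff_le]
    simp only [map_inf, map_sup]
    exact IsModularLattice.sup_inf_le_assoc_of_le _ (f.monotone h)

variable {Q : Type*} [Monoid Q]

theorem IsFracRightIdeal.left_translate {A : Submonoid Q} (hA : IsMaximalOrder A) {K : Set Q}
    (hK : IsFracRightIdeal A K) (hKv : IsDivisorial K) (w : Qˣ) :
    IsFracRightIdeal A {p | ((w⁻¹ : Qˣ) : Q) * p ∈ K} ∧
      IsDivisorial {p | ((w⁻¹ : Qˣ) : Q) * p ∈ K} := by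
  have hfrac : IsFracRightIdeal A {p | ((w⁻¹ : Qˣ) : Q) * p ∈ K} := by
    obtain ⟨u, hu⟩ := hK.exists_unit
    obtain ⟨v, hv⟩ := hK.exists_denom
    refine ⟨fun h hh p hp => ?_, ⟨w * u, by simpa using hu⟩, ⟨v * w⁻¹, fun p hp => ?_⟩⟩
    · have := hK.mul_mem h hh _ hp
      rwa [mul_assoc] at this
    · have := hv _ hp
      rwa [← mul_assoc] at this
  refine ⟨hfrac, Set.Subset.antisymm (fun p hp => ?_) fun p hp => ?_⟩
  · have h1 := ((hfrac.inv hA).mem_inv hA).1 hp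
    rw [Set.mem_ofPred_eq, ← show vClosure K = K from hKv]
    refine ((hK.inv hA).mem_inv hA).2 fun s hs => ?_
    rw [← mul_assoc]
    refine h1 _ ((hfrac.mem_inv hA).2 fun t ht => ?_)
    rw [mul_assoc]
    exact (hK.mem_inv hA).1 hs _ ht
  · exact ((hfrac.inv hA).mem_inv hA).2 fun s hs => (hfrac.mem_inv hA).1 hs p hp

variable {H : Submonoid Q}

/-- Intervals of divisorial left `H`-ideals satisfy both chain conditions: an ascending chain below `z` becomes a
chain of left `H`-ideals on multiplication by a denominator of `z`, and for a descending chain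
above `x` with a unit `w ∈ x`, the sets `w J⁻¹` form an ascending chain of right `H`-ideals. -/
theorem locallyFiniteLength_base (hH : IsArithmeticalMaximalOrder H) :
    LocallyFiniteLength (DivLeftIdeal (MaximalOrderClass.base hH.isMaximalOrder)) where
  wellFounded_gt z := by
    obtain ⟨w, hw⟩ := z.isFrac.exists_denom
    have hle : ∀ a : Set.Iic z, IsDivisorialLeftIdeal H
        (DivLeftIdeal.rmul _ w a.1 : Set Q) := by
      rintro ⟨a, ha⟩
      refine ⟨(DivLeftIdeal.rmul _ w a).isFrac, fun p hp => ?_,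
        (DivLeftIdeal.rmul _ w a).isDivisorial⟩
      have : p * ((w⁻¹ : Qˣ) : Q) * w ∈ H := hw _ (ha hp)
      simpa using this
    refine Subrelation.wf (fun {a b} (h : a > b) => ?_)
      (InvImage.wf (fun a : Set.Iic z => (⟨_, hle a⟩ : {I : Set Q // IsDivisorialLeftIdeal H I}))
        hH.acc_left.wf)
    exact (DivLeftIdeal.rmul (MaximalOrderClass.base hH.isMaximalOrder) w).strictMono h
  wellFounded_lt x := by
    obtain ⟨w, hw⟩ := x.isFrac.exists_unit
    have hm := hH.isMaximalOrder
    have hle : ∀ a : Set.Ici x, IsDivisorialRightIdeal H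
        {p | ((w⁻¹ : Qˣ) : Q) * p ∈ fracInv (a.1 : Set Q)} := by
      rintro ⟨a, ha⟩
      have hf : IsFracLeftIdeal H (a : Set Q) := a.isFrac
      obtain ⟨h1, h2⟩ := (hf.inv hm).left_translate hm (congrArg fracInv a.isDivisorial) w
      refine ⟨h1, fun p hp => ?_, h2⟩
      have := (hf.mem_inv hm).1 hp _ (ha hw)
      simpa using this
    refine Subrelation.wf (fun {a b} (h : a < b) => ?_)
      (InvImage.wf (fun a : Set.Ici x => (⟨_, hle a⟩ : {I : Set Q // IsDivisorialRightIdeal H I}))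
        hH.acc_right.wf)
    have ha : IsFracLeftIdeal H (a.1 : Set Q) := a.1.isFrac
    have hb : IsFracLeftIdeal H (b.1 : Set Q) := b.1.isFrac
    refine lt_of_le_not_ge (fun p hp => ha.inv_anti hm hb h.le hp) fun hle => h.not_ge ?_
    have h' : fracInv (a.1 : Set Q) ⊆ fracInv (b.1 : Set Q) := by
      intro p hp
      have := @hle (w * p) (by simpa using hp)
      simpa using this
    intro p hp
    rw [← show vClosure (a.1 : Set Q) = a.1 from a.1.isDivisorial]
    rw [← show vClosure (b.1 : Set Q) = b.1 from b.1.isDivisorial] at hp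
    exact (ha.mem_vcl hm).2 fun s hs => (hb.mem_vcl hm).1 hp s (h' hs)

theorem isModularLattice_base (hH : IsArithmeticalMaximalOrder H) :
    IsModularLattice (DivLeftIdeal (MaximalOrderClass.base hH.isMaximalOrder)) where
  sup_inf_le_assoc_of_le {x} y {z} h :=
    (hH.modular_left x y z x.isFrac x.isDivisorial y.isFrac y.isDivisorial z.isFrac
      z.isDivisorial h).subset

variable [hH : Fact (IsArithmeticalMaximalOrder H)]

instance (A : MaximalOrderClass H) : LocallyFiniteLength (DivLeftIdeal A) := by
  have := locallyFiniteLength_base hH.out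
  obtain ⟨k⟩ := nonempty_hom (MaximalOrderClass.base hH.out.isMaximalOrder) A
  exact LocallyFiniteLength.of_orderIso (DivLeftIdeal.smul k)

instance (A : MaximalOrderClass H) : IsModularLattice (DivLeftIdeal A) := by
  have := isModularLattice_base hH.out
  obtain ⟨k⟩ := nonempty_hom (MaximalOrderClass.base hH.out.isMaximalOrder) A
  exact IsModularLattice.of_orderIso (DivLeftIdeal.smul k)

end ChainConditions

/-! ### The vertex groups and the universal vertex group -/

section VertexGroups

variable {Q : Type*} [Monoid Q] {H : Submonoid Q} {A B C : MaximalOrderClass H}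

/-- The universal vertex group `𝔾` of `F_v(α)`. -/
abbrev NormGroup (H : Submonoid Q) : Type _ := universalVertexGroup (MaximalOrderClass H)

instance : MulLeftMono (A ⟶ A) := ⟨fun k _ _ h => comp_subset_comp_left (A := A) (B := A) k h⟩

instance : MulRightMono (A ⟶ A) := ⟨fun k _ _ h => comp_subset_comp_right (B := A) (C := A) k h⟩

theorem hom_le_iff {u v : A ⟶ B} : u ≤ v ↔ idealSet u ⊆ idealSet v := Iff.rfl

theorem vertex_exists_isGLB (x y : A ⟶ A) : ∃ z, IsGLB {x, y} z := by
  have hx := idealSet_isFrac x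
  have hy := idealSet_isFrac y
  have hl := hx.1.inter A.isMaximalOrder hy.1
  have hbi : IsFracBiIdeal A.order A.order (idealSet x ∩ idealSet y) := by
    refine ⟨hl, fun h hh p hp => ⟨hx.2.mul_mem h hh p hp.1, hy.2.mul_mem h hh p hp.2⟩,
      hl.exists_unit, ?_⟩
    obtain ⟨w, hw⟩ := hx.2.exists_denom
    exact ⟨w, fun p hp => hw p hp.1⟩
  refine ⟨hbi.toHom (hx.1.isDivisorial_inter A.isMaximalOrder hy.1 (idealSet_isDivisorial x)
    (idealSet_isDivisorial y)), ?_, ?_⟩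
  · simp only [lowerBounds_insert, lowerBounds_singleton]
    exact ⟨Set.inter_subset_left, Set.inter_subset_right⟩
  · intro z hz
    simp only [lowerBounds_insert, lowerBounds_singleton] at hz
    exact Set.subset_inter hz.1 hz.2

namespace NormGroup

/-- A conjugacy class intertwines the elements of `F_v(α)`. -/
theorem comp_eq (X : NormGroup H) (u : A ⟶ B) : X.1 A ≫ u = u ≫ X.1 B := by
  have h := X.2 A B u
  rw [Groupoid.vertexGroupIsomOfMap_apply] at h
  rw [← h]
  simp

theorem le_iff_subset (A : MaximalOrderClass H) {X Y : NormGroup H} :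
    X ≤ Y ↔ idealSet (X.1 A) ⊆ idealSet (Y.1 A) := by
  refine ⟨fun h => h A, fun h B => ?_⟩
  obtain ⟨u⟩ := nonempty_hom A B
  rw [hom_le_iff, ← comp_subset_comp_left_iff u, ← comp_eq, ← comp_eq]
  exact comp_subset_comp_right u h

theorem le_one_iff (A : MaximalOrderClass H) {X : NormGroup H} :
    X ≤ 1 ↔ idealSet (X.1 A) ⊆ A.order :=
  le_iff_subset A

instance : MulLeftMono (NormGroup H) :=
  ⟨fun X _ _ h A => comp_subset_comp_left (X.1 A) (h A)⟩

instance : MulRightMono (NormGroup H) :=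
  ⟨fun X _ _ h A => comp_subset_comp_right (X.1 A) (h A)⟩

theorem mul_apply (X Y : NormGroup H) (A : MaximalOrderClass H) :
    (X * Y).1 A = X.1 A ≫ Y.1 A := rfl

theorem one_apply (A : MaximalOrderClass H) : (1 : NormGroup H).1 A = 𝟙 A := rfl

end NormGroup

variable [hH : Fact (IsArithmeticalMaximalOrder H)]

theorem vertex_wellFounded (A : MaximalOrderClass H) :
    WellFounded fun a b : Set.Iic (1 : A ⟶ A) => a > b :=
  Subrelation.wf (fun {_ _} h => h)
    (InvImage.wf (fun a : Set.Iic (1 : A ⟶ A) =>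
      (⟨DivLeftIdeal.ofHom a.1, a.2⟩ : Set.Iic (DivLeftIdeal.unit A)))
      (LocallyFiniteLength.wellFounded_gt (DivLeftIdeal.unit A)))

theorem vertex_mul_comm (x y : A ⟶ A) : x * y = y * x :=
  mul_comm_of_wellFounded (vertex_wellFounded A) vertex_exists_isGLB x y

namespace NormGroup

theorem exists_eq (x : A ⟶ A) : ∃ X : NormGroup H, X.1 A = x :=
  (universalVertexGroup_eval_bijective nonempty_hom (fun _ => vertex_mul_comm) A).2 x

theorem wellFounded : WellFounded fun a b : Set.Iic (1 : NormGroup H) => a > b := by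
  let A := MaximalOrderClass.base hH.out.isMaximalOrder
  refine Subrelation.wf (fun {a b} h => ?_)
    (InvImage.wf (fun a : Set.Iic (1 : NormGroup H) =>
      (⟨a.1.1 A, a.2 A⟩ : Set.Iic (1 : A ⟶ A))) (vertex_wellFounded A))
  have h' : (b : NormGroup H) < a := h
  exact lt_of_le_not_ge (h'.le A) fun hle => h'.not_ge ((le_iff_subset A).2 hle)

/-- Every element of `F_v(α)` contains a two-sided ideal. For `A = H` this is the boundedness of
`H`. In general, with `a : H → A` and two-sided `H`-ideals `X₁ ⊆ a u` and `X₂` such that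
`X₂ a ⊆ H`, the class of `X₁ X₂` will do, as `X₁ X₂ a ⊆ X₁ ⊆ a u`. -/
theorem exists_subset (u : A ⟶ B) : ∃ X : NormGroup H, idealSet (X.1 A) ⊆ idealSet u := by
  let O := MaximalOrderClass.base hH.out.isMaximalOrder
  have key : ∀ J : Set Q, IsFracLeftIdeal H J → IsFracRightIdeal H J →
      ∃ X : NormGroup H, IsFracBiIdeal O.order O.order J ∧
        idealSet (X.1 O) = vClosure J := by
    intro J hl hr
    have hbi : IsFracBiIdeal O.order O.order J := ⟨hl, hr⟩
    obtain ⟨X, hX⟩ := exists_eq (A := O) ((hbi.vcl O.isMaximalOrder O.isMaximalOrder).toHom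
      (congrArg fracInv (hbi.inv_vcl O.isMaximalOrder O.isMaximalOrder)))
    exact ⟨X, hbi, by rw [hX]; rfl⟩
  obtain ⟨a⟩ := nonempty_hom O A
  obtain ⟨J₁, hl, hr, hJ₁⟩ := hH.out.bounded _ (Or.inl (idealSet_isFrac (a ≫ u)).1)
  obtain ⟨X₁, -, h₁⟩ := key J₁ hl hr
  replace h₁ : idealSet (X₁.1 O) ⊆ idealSet (a ≫ u) := by
    rw [h₁]
    exact hl.vcl_subset O.isMaximalOrder (idealSet_isFrac _).1 (idealSet_isDivisorial _) hJ₁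
  obtain ⟨J₂, hl, hr, hJ₂⟩ := hH.out.bounded _ (Or.inr (idealSet_isFrac (Groupoid.inv a)).2)
  obtain ⟨X₂, hbi, h₂⟩ := key J₂ hl hr
  replace h₂ : idealSet (X₂.1 O) ⊆ idealSet (Groupoid.inv a) := by
    rw [h₂]
    exact vClosure_subset_right hbi _ hJ₂
  have h₂' : idealSet (X₂.1 O ≫ a) ⊆ A.order := by
    have := comp_subset_comp_right a h₂
    rwa [Groupoid.inv_comp] at this
  refine ⟨X₁ * X₂, ?_⟩
  rw [← comp_subset_comp_left_iff a, ← comp_eq, mul_apply, Category.assoc]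
  exact (comp_subset_left _ ((subset_left_iff_subset_right _).2 h₂')).trans h₁

end NormGroup

end VertexGroups

/-! ### The abstract norm -/

section AbstractNorm

variable {Q : Type*} [Monoid Q] {H : Submonoid Q} {A B C D : MaximalOrderClass H}

namespace DivLeftIdeal

theorem smul_le_iff {k : A ⟶ B} {y : DivLeftIdeal B} {x : DivLeftIdeal A} :
    smul k y ≤ x ↔ ∀ p ∈ idealSet k, ∀ z ∈ y, p * z ∈ x := by
  obtain ⟨C, v, rfl⟩ := y.exists_hom
  obtain ⟨D, u, rfl⟩ := x.exists_hom
  exact idealSet_comp_subset k v u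

theorem smul_smul (k : A ⟶ B) (l : B ⟶ C) (x : DivLeftIdeal C) :
    smul k (smul l x) = smul (k ≫ l) x := by
  obtain ⟨D, u, rfl⟩ := x.exists_hom
  simp

theorem smul_le_self_iff (X : NormGroup H) (x : DivLeftIdeal A) :
    smul (X.1 A) x ≤ x ↔ X ≤ 1 := by
  obtain ⟨B, u, rfl⟩ := x.exists_hom
  rw [smul_ofHom, ofHom_le, NormGroup.le_iff_subset A]
  constructor
  · intro h
    have := comp_subset_comp_right_iff (u := X.1 A) (v := 𝟙 A) u
    rw [Category.id_comp] at this
    exact this.1 h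
  · exact fun h => comp_subset_right h u

theorem isMaximal_iff_covBy {x : DivLeftIdeal A} :
    IsMaximalDivisorialLeftIdeal A.order (x : Set Q) ↔ x ⋖ unit A := by
  constructor
  · rintro ⟨⟨⟨-, hle, -⟩, hne⟩, hmax⟩
    refine ⟨lt_of_le_of_ne hle fun h => hne (congrArg _ h), fun y hxy hy => hxy.not_ge ?_⟩
    exact hmax ⟨⟨y.isFrac, hy.le, y.isDivisorial⟩, fun h => hy.ne (SetLike.coe_injective h)⟩ hxy.le
  · intro h
    refine ⟨⟨⟨x.isFrac, h.le, x.isDivisorial⟩, fun e => h.lt.ne (SetLike.coe_injective e)⟩, ?_⟩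
    rintro J ⟨⟨h1, h2, h3⟩, h4⟩ hle
    let y : DivLeftIdeal A := ⟨J, h1, h3⟩
    rcases h.eq_or_eq (show x ≤ y from hle) h2 with e | e
    · exact e.le
    · exact absurd (congrArg (SetLike.coe : DivLeftIdeal A → Set Q) e) h4

/-- The classes `𝒳` with `𝒳 y ⊆ x`. For `x = v u` and `y = v` these are the classes whose
representative is contained in `u`. -/
def factorSet (x y : DivLeftIdeal A) : Set (NormGroup H) := {X | smul (X.1 A) y ≤ x}

theorem mem_factorSet {x y : DivLeftIdeal A} {X : NormGroup H} :
    X ∈ factorSet x y ↔ smul (X.1 A) y ≤ x := Iff.rfl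

/-- Perspective steps have the same classes: both sides force `𝒳` to be integral. -/
theorem factorSet_sup (x y : DivLeftIdeal A) : factorSet x (x ⊔ y) = factorSet (x ⊓ y) y := by
  ext X
  rw [mem_factorSet, mem_factorSet, map_sup, sup_le_iff, le_inf_iff, smul_le_self_iff,
    smul_le_self_iff, and_comm]

theorem factorSet_smul (k : A ⟶ B) (x y : DivLeftIdeal B) :
    factorSet (smul k x) (smul k y) = factorSet x y := by
  ext X
  rw [mem_factorSet, mem_factorSet, smul_smul, X.comp_eq, ← smul_smul, OrderIso.le_iff_le]

theorem factorSet_rmul (q : Qˣ) (x y : DivLeftIdeal A) :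
    factorSet (rmul A q x) (rmul A q y) = factorSet x y := by
  ext X
  rw [mem_factorSet, mem_factorSet, smul_le_iff, smul_le_iff]
  constructor
  · intro h p hp z hz
    have := h p hp (z * q) (by simpa [mem_rmul] using hz)
    simpa [mem_rmul, mul_assoc] using this
  · intro h p hp z hz
    have := h p hp _ hz
    simpa [mem_rmul, mul_assoc] using this

theorem factorSet_ofHom (u : A ⟶ B) : factorSet (ofHom u) (unit A) =
    {X | idealSet (X.1 A) ⊆ idealSet u} := by
  ext X
  rw [mem_factorSet, smul_unit]
  rfl

/-- The norm of a step `x ≤ y`: the largest class `𝒳` with `𝒳 y ⊆ x`. It exists for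
`x ≤ y` (`isGreatest_factorNorm`) and is a junk value otherwise. -/
noncomputable def factorNorm (x y : DivLeftIdeal A) : NormGroup H :=
  Classical.epsilon fun X => IsGreatest (factorSet x y) X

theorem factorNorm_sup (x y : DivLeftIdeal A) : factorNorm x (x ⊔ y) = factorNorm (x ⊓ y) y := by
  rw [factorNorm, factorSet_sup, factorNorm]

theorem factorNorm_smul (k : A ⟶ B) (x y : DivLeftIdeal B) :
    factorNorm (smul k x) (smul k y) = factorNorm x y := by
  rw [factorNorm, factorSet_smul, factorNorm]

theorem factorNorm_rmul (q : Qˣ) (x y : DivLeftIdeal A) :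
    factorNorm (rmul A q x) (rmul A q y) = factorNorm x y := by
  rw [factorNorm, factorSet_rmul, factorNorm]

/-- Every step is a translate of a step below an order. -/
theorem exists_eq_smul {x y : DivLeftIdeal A} : ∃ (B C : MaximalOrderClass H) (v : A ⟶ B)
    (u : B ⟶ C), y = smul v (unit B) ∧ x = smul v (ofHom u) := by
  obtain ⟨B, v, rfl⟩ := y.exists_hom
  obtain ⟨C, u, rfl⟩ := x.exists_hom
  exact ⟨B, C, v, Groupoid.inv v ≫ u, by simp, by simp⟩

end DivLeftIdeal

variable [hH : Fact (IsArithmeticalMaximalOrder H)]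

open DivLeftIdeal

/-- The largest two-sided ideal in `u` is the divisorial closure of the union of all of them, which is
not empty because `H` is bounded. -/
theorem exists_isGreatest_of_integral (u : A ⟶ B) (hu : idealSet u ⊆ A.order) :
    ∃ g : NormGroup H, IsGreatest {X | idealSet (X.1 A) ⊆ idealSet u} g := by
  obtain ⟨X₀, h₀⟩ := NormGroup.exists_subset u
  let J : Set Q := ⋃ X : {X : NormGroup H // idealSet (X.1 A) ⊆ idealSet u},
    idealSet (X.1.1 A)
  have hJu : J ⊆ idealSet u := Set.iUnion_subset fun X => X.2
  obtain ⟨w, hw⟩ := (idealSet_isFrac (X₀.1 A)).1.exists_unit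
  have hwJ : (w : Q) ∈ J := Set.mem_iUnion.2 ⟨⟨X₀, h₀⟩, hw⟩
  have hbi : IsFracBiIdeal A.order A.order J := by
    refine ⟨⟨fun h hh x hx => ?_, ⟨w, hwJ⟩, ⟨1, fun x hx => by simpa using hu (hJu hx)⟩⟩,
      ⟨fun h hh x hx => ?_, ⟨w, hwJ⟩, ⟨1, fun x hx => by simpa using hu (hJu hx)⟩⟩⟩
    · obtain ⟨X, hX⟩ := Set.mem_iUnion.1 hx
      exact Set.mem_iUnion.2 ⟨X, (idealSet_isFrac _).1.smul_mem h hh x hX⟩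
    · obtain ⟨X, hX⟩ := Set.mem_iUnion.1 hx
      exact Set.mem_iUnion.2 ⟨X, (idealSet_isFrac _).2.mul_mem h hh x hX⟩
  obtain ⟨g, hg⟩ := NormGroup.exists_eq (A := A)
    ((hbi.vcl A.isMaximalOrder A.isMaximalOrder).toHom
      (congrArg fracInv (hbi.inv_vcl A.isMaximalOrder A.isMaximalOrder)))
  have hg' : idealSet (g.1 A) = vClosure J := by rw [hg]; rfl
  refine ⟨g, ?_, fun X hX => (NormGroup.le_iff_subset A).2 ?_⟩
  · rw [Set.mem_ofPred_eq, hg']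
    exact hbi.1.vcl_subset A.isMaximalOrder (idealSet_isFrac u).1 (idealSet_isDivisorial u) hJu
  · rw [hg']
    exact (Set.subset_iUnion (fun X : {X : NormGroup H //
      idealSet (X.1 A) ⊆ idealSet u} => idealSet (X.1.1 A)) ⟨X, hX⟩).trans
        (hbi.1.subset_vcl A.isMaximalOrder)

namespace DivLeftIdeal

theorem isGreatest_factorNorm {x y : DivLeftIdeal A} (h : x ≤ y) :
    IsGreatest (factorSet x y) (factorNorm x y) := by
  refine Classical.epsilon_spec (p := fun X => IsGreatest (factorSet x y) X) ?_
  obtain ⟨B, C, v, u, rfl, rfl⟩ := exists_eq_smul (x := x) (y := y)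
  rw [OrderIso.le_iff_le] at h
  rw [factorSet_smul, factorSet_ofHom]
  exact exists_isGreatest_of_integral u h

theorem factorNorm_lt_one {x y : DivLeftIdeal A} (h : x < y) : factorNorm x y < 1 := by
  have hmem : smul ((factorNorm x y).1 A) y ≤ x := (isGreatest_factorNorm h.le).1
  refine lt_of_le_of_ne ((smul_le_self_iff _ y).1 (hmem.trans h.le)) fun e => h.not_ge ?_
  rw [e, NormGroup.one_apply] at hmem
  obtain ⟨B, v, rfl⟩ := y.exists_hom
  simpa using hmem

/-- The multiset of norms of the composition factors of the interval `[x, y]`, for `x ≤ y`. -/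
noncomputable abbrev factors (x y : DivLeftIdeal A) : Multiset (NormGroup H) :=
  chainLabels factorNorm x y

theorem factors_add {x y z : DivLeftIdeal A} (h : x ≤ y) (h' : y ≤ z) :
    factors x y + factors y z = factors x z :=
  chainLabels_add factorNorm_sup h h'

theorem factors_covBy {x y : DivLeftIdeal A} (h : x ⋖ y) : factors x y = {factorNorm x y} :=
  chainLabels_covBy factorNorm_sup h

theorem factors_smul (k : A ⟶ B) {x y : DivLeftIdeal B} (h : x ≤ y) :
    factors (smul k x) (smul k y) = factors x y :=
  chainLabels_map factorNorm_sup (smul k) (factorNorm_smul k) h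

theorem factors_rmul (q : Qˣ) {x y : DivLeftIdeal A} (h : x ≤ y) :
    factors (rmul A q x) (rmul A q y) = factors x y :=
  chainLabels_map factorNorm_sup (rmul A q) (factorNorm_rmul q) h

end DivLeftIdeal

/-- The abstract norm. For integral `u` it is the product of the norms of the composition factors
of `[u, A]`, and in general the quotient of two such products. -/
noncomputable def abstractNorm (u : A ⟶ B) : NormGroup H :=
  relNorm factorNorm (ofHom u) (unit A)

theorem abstractNorm_of_integral {u : A ⟶ B} (h : ofHom u ≤ unit A) :
    abstractNorm u = (factors (ofHom u) (unit A)).prod :=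
  relNorm_of_le factorNorm_sup h

theorem abstractNorm_of_covBy {u : A ⟶ B} (h : ofHom u ⋖ unit A) :
    abstractNorm u = factorNorm (ofHom u) (unit A) := by
  rw [abstractNorm_of_integral h.le, factors_covBy h, Multiset.prod_singleton]

theorem abstractNorm_comp (u : A ⟶ B) (v : B ⟶ C) :
    abstractNorm (u ≫ v) = abstractNorm u * abstractNorm v := by
  have h := relNorm_map factorNorm_sup (smul u) (factorNorm_smul u) (x := ofHom v) (y := unit B)
  rw [smul_unit, smul_ofHom] at h
  rw [abstractNorm, abstractNorm, abstractNorm, mul_comm, ← h, relNorm_mul factorNorm_sup]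

theorem abstractNorm_id (A : MaximalOrderClass H) : abstractNorm (𝟙 A) = 1 := by
  rw [abstractNorm_of_integral le_rfl, factors, unit, chainLabels_self, Multiset.prod_zero]

theorem abstractNorm_inv (u : A ⟶ B) : abstractNorm (Groupoid.inv u) = (abstractNorm u)⁻¹ := by
  rw [eq_inv_iff_mul_eq_one, ← abstractNorm_comp, Groupoid.inv_comp, abstractNorm_id]

/-- A class that is maximal below `1` is the norm of every maximal divisorial left ideal containing
its representative. -/
theorem factorNorm_eq_of_covBy {P : NormGroup H} (hP : P ⋖ 1) {x : DivLeftIdeal A}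
    (hx : x < unit A) (h : ofHom (P.1 A) ≤ x) : factorNorm x (unit A) = P := by
  have hmem : P ∈ factorSet x (unit A) := by rwa [mem_factorSet, smul_unit]
  have hlt := factorNorm_lt_one hx
  exact (hP.eq_or_eq ((isGreatest_factorNorm hx.le).2 hmem) hlt.le).resolve_right hlt.ne

theorem exists_covBy_of_lt_one {X : NormGroup H} (hX : X < 1) (A : MaximalOrderClass H) :
    ∃ x : DivLeftIdeal A, ofHom (X.1 A) ≤ x ∧ x ⋖ unit A := by
  refine exists_le_covBy (lt_of_le_not_ge (hX.le A) fun h => hX.not_ge ?_)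
  exact (NormGroup.le_iff_subset A).2 h

theorem exists_abstractNorm_eq_of_le_one {X : NormGroup H} (hX : X ≤ 1)
    (A : MaximalOrderClass H) : ∃ (B : MaximalOrderClass H) (u : A ⟶ B), abstractNorm u = X := by
  replace hX := mem_closure_covBy_one NormGroup.wellFounded hX
  induction hX using Submonoid.closure_induction generalizing A with
  | mem P hP =>
    obtain ⟨x, hPx, hx⟩ := exists_covBy_of_lt_one hP.lt A
    obtain ⟨B, u, rfl⟩ := x.exists_hom
    exact ⟨B, u, by rw [abstractNorm_of_covBy hx, factorNorm_eq_of_covBy hP hx.lt hPx]⟩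
  | one => exact ⟨A, 𝟙 A, abstractNorm_id A⟩
  | mul X Y _ _ hX hY =>
    obtain ⟨B, u, rfl⟩ := hX A
    obtain ⟨C, v, rfl⟩ := hY B
    exact ⟨C, u ≫ v, abstractNorm_comp u v⟩

theorem isAbstractNorm_abstractNorm :
    IsAbstractNorm (H := H) fun _ _ u => abstractNorm u where
  map_comp := abstractNorm_comp
  surjective X := by
    let A := MaximalOrderClass.base hH.out.isMaximalOrder
    -- `X = Z⁻¹ Y` with integral `Z`, `Y`
    obtain ⟨z, hz⟩ := vertex_exists_isGLB (X⁻¹.1 A) (1 : A ⟶ A)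
    obtain ⟨Z, rfl⟩ := NormGroup.exists_eq z
    have h1 : Z ≤ 1 := (NormGroup.le_iff_subset A).2 (hz.1 (by simp))
    have h2 : Z ≤ X⁻¹ := (NormGroup.le_iff_subset A).2 (hz.1 (by simp))
    have h3 : Z * X ≤ 1 := by
      have := mul_le_mul_left h2 X
      rwa [inv_mul_cancel] at this
    obtain ⟨B, u, hu⟩ := exists_abstractNorm_eq_of_le_one h1 A
    obtain ⟨C, v, hv⟩ := exists_abstractNorm_eq_of_le_one h3 A
    refine ⟨B, C, Groupoid.inv u ≫ v, ?_⟩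
    rw [abstractNorm_comp, abstractNorm_inv, hu, hv, inv_mul_cancel_left]
  eq_lowerBound {A B} u hu := by
    have hu' : ofHom u ⋖ unit A := isMaximal_iff_covBy.1 hu
    rw [abstractNorm_of_covBy hu']
    have := isGreatest_factorNorm hu'.le
    rw [factorSet_ofHom] at this
    exact this.isLUB

/-- Any abstract norm is determined along maximal chains. -/
theorem IsAbstractNorm.eq_mul_prod
    {η : ∀ A B : MaximalOrderClass H, (A ⟶ B) → universalVertexGroup (MaximalOrderClass H)}
    (hη : IsAbstractNorm η) {x y : DivLeftIdeal A} {m : Multiset (NormGroup H)}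
    (h : LabelledChain factorNorm x y m) (u : A ⟶ B) (hu : ofHom u = x) (v : A ⟶ C)
    (hv : ofHom v = y) : η A B u = η A C v * m.prod := by
  induction h generalizing B with
  | refl x =>
    subst hu
    have hBC : B = C := by
      have hr : B.order = C.order := by
        rw [← DivisorialHom.rightOrder_eq u, ← DivisorialHom.rightOrder_eq v]
        exact congrArg (fun x : DivLeftIdeal A => rightOrder (x : Set Q)) hv.symm
      cases B
      cases C
      congr
    subst hBC
    rw [ofHom_injective hv, Multiset.prod_zero, mul_one]
  | @step x z y m h _ ih =>
    obtain ⟨D, w, hw⟩ := z.exists_hom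
    have e : u = w ≫ (Groupoid.inv w ≫ u) := by simp
    have hcov : ofHom (Groupoid.inv w ≫ u) ⋖ unit D := by
      rw [← apply_covBy_apply_iff (smul w), smul_unit, smul_ofHom, ← e, hu, hw]
      exact h
    have h1 := hη.eq_lowerBound (Groupoid.inv w ≫ u) (isMaximal_iff_covBy.2 hcov)
    have h2 := isGreatest_factorNorm h.le
    have hx : x = smul w (ofHom (Groupoid.inv w ≫ u)) := by rw [smul_ofHom, ← e, hu]
    have hz : z = smul w (unit D) := by rw [smul_unit, hw]
    rw [hx, hz, factorSet_smul, factorSet_ofHom, ← hx, ← hz] at h2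
    rw [e, hη.map_comp, h1.unique h2.isLUB, ih w hw hv, Multiset.prod_cons, mul_assoc,
      mul_comm m.prod]

theorem IsAbstractNorm.eq_abstractNorm
    {η : ∀ A B : MaximalOrderClass H, (A ⟶ B) → universalVertexGroup (MaximalOrderClass H)}
    (hη : IsAbstractNorm η) : η = fun _ _ u => abstractNorm u := by
  funext A B u
  obtain ⟨C, w, hw⟩ := (ofHom u ⊓ unit A).exists_hom
  have h1 := hη.eq_mul_prod (labelledChain_chainLabels factorNorm
    (inf_le_left : ofHom u ⊓ unit A ≤ ofHom u)) w hw u rfl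
  have h2 := hη.eq_mul_prod (labelledChain_chainLabels factorNorm
    (inf_le_right : ofHom u ⊓ unit A ≤ unit A)) w hw (𝟙 A) rfl
  have hone : η A A (𝟙 A) = 1 := by
    have := hη.map_comp (𝟙 A) (𝟙 A)
    rwa [Category.comp_id, left_eq_mul] at this
  rw [hone, one_mul] at h2
  rw [abstractNorm, relNorm, ← h2, h1, mul_div_cancel_right]

end AbstractNorm

/-! ### Rearranging composition factors -/

section Rearranging

variable {Q : Type*} [Monoid Q] {H : Submonoid Q} {A B C : MaximalOrderClass H}
  [hH : Fact (IsArithmeticalMaximalOrder H)]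

namespace DivLeftIdeal

/-- If `P = η(x, y) < R < 1`, then `S = R⁻¹ P` satisfies `S y = S (R y ∨ x) = P y ∨ S x ⊆ x`, so
that `S ≤ P = R S`, which is absurd. -/
theorem factorNorm_covBy_one {x y : DivLeftIdeal A} (h : x ⋖ y) : factorNorm x y ⋖ 1 := by
  have hg := isGreatest_factorNorm h.le
  have hmem : smul ((factorNorm x y).1 A) y ≤ x := hg.1
  refine ⟨factorNorm_lt_one h.lt, fun R hR hR1 => ?_⟩
  set P := factorNorm x y
  have hRx : ¬ smul (R.1 A) y ≤ x := fun hle => hR.not_ge (hg.2 hle)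
  have hRy : smul (R.1 A) y ≤ y := (smul_le_self_iff R y).2 hR1.le
  have hsup : smul (R.1 A) y ⊔ x = y := by
    rcases h.eq_or_eq (c := smul (R.1 A) y ⊔ x) le_sup_right (sup_le hRy h.le) with e | e
    · exact absurd (le_sup_left.trans e.le) hRx
    · exact e
  have hS1 : P * R⁻¹ ≤ 1 := by
    have := mul_le_mul_left hR.le R⁻¹
    rwa [mul_inv_cancel] at this
  have hS : smul ((P * R⁻¹).1 A) y ≤ x := by
    rw [← hsup, map_sup, smul_smul, ← NormGroup.mul_apply, inv_mul_cancel_right]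
    exact sup_le hmem ((smul_le_self_iff _ x).2 hS1)
  have hle : P * R⁻¹ ≤ P := hg.2 hS
  have : 1 ≤ R := by
    have h1 := mul_le_mul_right hle P⁻¹
    rw [inv_mul_cancel_left, inv_mul_cancel] at h1
    exact inv_le_one'.1 h1
  exact hR1.not_ge this

/-- Two adjacent composition factors of different norm can be interchanged: for `q = η(x, y) z`
one has `y ∧ q = η(x, y) y ⊆ x`, so that `y' = x ∨ q` is a complement of `y` in `[x, z]`. -/
theorem exists_swap {x y z : DivLeftIdeal A} (hxy : x ⋖ y) (hyz : y ⋖ z)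
    (hne : factorNorm x y ≠ factorNorm y z) :
    ∃ y', x ⋖ y' ∧ y' ⋖ z ∧ factorNorm y' z = factorNorm x y := by
  have hmem : smul ((factorNorm x y).1 A) y ≤ x := (isGreatest_factorNorm hxy.le).1
  set q := smul ((factorNorm x y).1 A) z with hq
  have hqz : q ≤ z := (smul_le_self_iff _ z).2 (factorNorm_lt_one hxy.lt).le
  have hqy : ¬ q ≤ y := by
    intro hle
    rcases (factorNorm_covBy_one hxy).eq_or_eq ((isGreatest_factorNorm hyz.le).2 hle)
      (factorNorm_lt_one hyz.lt).le with e | e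
    · exact hne e.symm
    · exact (factorNorm_lt_one hyz.lt).ne e
  have hyq : y ⊔ q = z := by
    rcases hyz.eq_or_eq (c := y ⊔ q) le_sup_left (sup_le hyz.le hqz) with e | e
    · exact absurd (le_sup_right.trans e.le) hqy
    · exact e
  have hinf : y ⊓ q ≤ x := by
    have hcov : smul ((factorNorm x y).1 A) y ⋖ q := (apply_covBy_apply_iff (smul _)).2 hyz
    rcases hcov.eq_or_eq (c := y ⊓ q) (le_inf (hmem.trans hxy.le) hcov.le) inf_le_right with e | e
    · rwa [e]
    · exact absurd (inf_eq_right.1 e) hqy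
  have h1 : y ⊓ (x ⊔ q) = x := by
    refine le_antisymm ?_ (le_inf hxy.le le_sup_left)
    rw [inf_comm]
    exact (IsModularLattice.sup_inf_le_assoc_of_le q hxy.le).trans
      (sup_le le_rfl (by rwa [inf_comm]))
  have h2 : y ⊔ (x ⊔ q) = z := by rw [← sup_assoc, sup_eq_left.2 hxy.le, hyq]
  refine ⟨x ⊔ q, ?_, ?_, ?_⟩
  · have := inf_covBy_of_covBy_sup_left (a := y) (b := x ⊔ q) (by rwa [h2])
    rwa [h1] at this
  · have := covBy_sup_of_inf_covBy_left (a := y) (b := x ⊔ q) (by rwa [h1])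
    rwa [h2] at this
  · have := factorNorm_sup (x ⊔ q) y
    rwa [sup_comm _ y, h2, inf_comm, h1] at this

/-- The first step of a chain can be moved to the top. -/
theorem exists_covBy_top_of_labelledChain {x z : DivLeftIdeal A}
    {m : Multiset (NormGroup H)} (h : LabelledChain factorNorm x z m) {w : DivLeftIdeal A}
    (hw : w ⋖ x) : ∃ y, w ≤ y ∧ y ⋖ z ∧ factorNorm y z = factorNorm w x := by
  induction h generalizing w with
  | refl x => exact ⟨w, le_rfl, hw, rfl⟩
  | @step x y z m hxy c ih =>
    by_cases hne : factorNorm w x = factorNorm x y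
    · obtain ⟨t, ht, htz, e⟩ := ih hxy
      exact ⟨t, hw.le.trans ht, htz, e.trans hne.symm⟩
    · obtain ⟨x', hwx', hx'y, e'⟩ := exists_swap hw hxy hne
      obtain ⟨t, ht, htz, e⟩ := ih hx'y
      exact ⟨t, hwx'.le.trans ht, htz, e.trans e'⟩

/-- Every composition factor can be moved to the top. -/
theorem exists_covBy_of_mem_factors {x z : DivLeftIdeal A} (hxz : x ≤ z) {g : NormGroup H}
    (hg : g ∈ factors x z) : ∃ y, x ≤ y ∧ y ⋖ z ∧ factorNorm y z = g := by
  have h := labelledChain_chainLabels factorNorm hxz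
  change LabelledChain factorNorm x z (factors x z) at h
  generalize factors x z = m at h hg
  induction h with
  | refl x => simp at hg
  | @step x y z m hxy c ih =>
    rcases Multiset.mem_cons.1 hg with rfl | hg
    · exact exists_covBy_top_of_labelledChain c hxy
    · obtain ⟨t, ht, htz, e⟩ := ih c.le hg
      exact ⟨t, hxy.le.trans ht, htz, e⟩

/-- Every decomposition of the multiset of (images of) the composition factors of an interval
is realized by an intermediate element. -/
theorem exists_between_of_map_factors_eq_add {T : Type*} (f : NormGroup H → T)
    {x z : DivLeftIdeal A} (hxz : x ≤ z) {S₁ S₂ : Multiset T}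
    (h : (factors x z).map f = S₁ + S₂) :
    ∃ y, x ≤ y ∧ y ≤ z ∧ (factors x y).map f = S₁ ∧ (factors y z).map f = S₂ := by
  induction S₂ using Multiset.induction generalizing z with
  | empty =>
    exact ⟨z, hxz, le_rfl, by simpa using h, by rw [factors, chainLabels_self, Multiset.map_zero]⟩
  | cons s S₂ ih =>
    have hs : s ∈ (factors x z).map f := by rw [h]; simp
    obtain ⟨g, hg, rfl⟩ := Multiset.mem_map.1 hs
    obtain ⟨y, hxy, hyz, rfl⟩ := exists_covBy_of_mem_factors hxz hg
    have hadd := factors_add hxy hyz.le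
    rw [← hadd, Multiset.map_add, factors_covBy hyz, Multiset.map_singleton,
      ← Multiset.singleton_add, add_left_comm, add_comm, add_right_inj] at h
    obtain ⟨t, hxt, hty, e1, e2⟩ := ih hxy h
    refine ⟨t, hxt, hty.trans hyz.le, e1, ?_⟩
    rw [← factors_add hty hyz.le, Multiset.map_add, e2, factors_covBy hyz, Multiset.map_singleton,
      add_comm, Multiset.singleton_add]

/-- Every composition factor is the norm of a maximal integral element. -/
theorem exists_hom_of_mem_factors {x z : DivLeftIdeal A} (hxz : x ≤ z) {g : NormGroup H}
    (hg : g ∈ factors x z) : ∃ (B C : MaximalOrderClass H) (u : B ⟶ C),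
      IsMaximalDivisorialLeftIdeal B.order (idealSet u) ∧ abstractNorm u = g := by
  obtain ⟨y, -, hyz, rfl⟩ := exists_covBy_of_mem_factors hxz hg
  obtain ⟨B, C, v, u, rfl, rfl⟩ := exists_eq_smul (x := y) (y := z)
  rw [apply_covBy_apply_iff] at hyz
  exact ⟨B, C, u, isMaximal_iff_covBy.2 hyz, by
    rw [abstractNorm_of_covBy hyz, factorNorm_smul]⟩

end DivLeftIdeal

end Rearranging

/-! ### Finiteness of intervals -/

section FiniteIntervals

variable {Q : Type*} [Monoid Q] {H : Submonoid Q} {A B C : MaximalOrderClass H}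
  [hH : Fact (IsArithmeticalMaximalOrder H)]

open DivLeftIdeal

theorem NormGroup.isMaximalDivisorialIdeal {P : NormGroup H} (hP : P ⋖ 1)
    (A : MaximalOrderClass H) : IsMaximalDivisorialIdeal A.order (idealSet (P.1 A)) := by
  have hf := idealSet_isFrac (P.1 A)
  have hle := (NormGroup.le_one_iff A).1 hP.le
  refine ⟨⟨⟨hf.1, hle, idealSet_isDivisorial _⟩, ⟨hf.2, hle, idealSet_isDivisorial _⟩,
    fun e => hP.lt.not_ge ((NormGroup.le_iff_subset A).2 e.ge)⟩, ?_⟩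
  rintro J ⟨⟨hl, hJ, hv⟩, ⟨hr, -, -⟩, hne⟩ hPJ
  obtain ⟨R, hR⟩ := NormGroup.exists_eq (A := A)
    (IsFracBiIdeal.toHom (A := A) (B := A) ⟨hl, hr⟩ hv)
  have hRJ : idealSet (R.1 A) = J := by rw [hR]; rfl
  rcases hP.eq_or_eq ((NormGroup.le_iff_subset A).2 (hPJ.trans hRJ.ge))
    ((NormGroup.le_one_iff A).2 (hRJ.le.trans hJ)) with e | e
  · rw [← e, hRJ]
  · rw [e] at hRJ
    exact absurd hRJ.symm hne

omit hH in
/-- Maximal divisorial left ideals are prime with respect to integral two-sided ideals. -/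
theorem DivLeftIdeal.le_or_le_of_mul_le {x : DivLeftIdeal A} (hx : x ⋖ unit A)
    {X Y : NormGroup H} (hX : X ≤ 1) (hY : Y ≤ 1) (h : ofHom ((X * Y).1 A) ≤ x) :
    ofHom (X.1 A) ≤ x ∨ ofHom (Y.1 A) ≤ x := by
  by_contra! hcon
  have hsup : ofHom (Y.1 A) ⊔ x = unit A := by
    rcases hx.eq_or_eq (c := ofHom (Y.1 A) ⊔ x) le_sup_right
      (sup_le ((NormGroup.le_one_iff A).1 hY) hx.le) with e | e
    · exact absurd (le_sup_left.trans e.le) hcon.2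
    · exact e
  apply hcon.1
  rw [← smul_unit, ← hsup, map_sup]
  exact sup_le h ((smul_le_self_iff X x).2 hX)

variable (hfin : ∀ (A : MaximalOrderClass H) (P : Set Q), IsMaximalDivisorialIdeal A.order P →
  {I : Set Q | IsMaximalDivisorialLeftIdeal A.order I ∧ P ⊆ I}.Finite)
include hfin

/-- Only finitely many maximal divisorial left ideals contain a given integral two-sided ideal `X`,
because each of them contains one of the maximal two-sided factors of `X`. -/
theorem DivLeftIdeal.finite_covBy {X : NormGroup H} (hX : X ≤ 1) (A : MaximalOrderClass H) :
    {x : DivLeftIdeal A | x ⋖ unit A ∧ ofHom (X.1 A) ≤ x}.Finite := by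
  replace hX := mem_closure_covBy_one NormGroup.wellFounded hX
  induction hX using Submonoid.closure_induction with
  | mem P hP =>
    refine ((hfin A _ (P.isMaximalDivisorialIdeal hP A)).preimage
      SetLike.coe_injective.injOn).subset fun x hx => ?_
    exact ⟨isMaximal_iff_covBy.2 hx.1, hx.2⟩
  | one =>
    refine Set.finite_empty.subset fun x hx => hx.1.lt.not_ge hx.2
  | mul X Y hX' hY' hX hY =>
    refine (hX.union hY).subset fun x hx => ?_
    rcases le_or_le_of_mul_le hx.1 (le_one_of_mem_closure hX') (le_one_of_mem_closure hY') hx.2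
      with h | h
    · exact Or.inl ⟨hx.1, h⟩
    · exact Or.inr ⟨hx.1, h⟩

/-- By induction on the length: `[x, A]` is the union of `{A}` and of the finitely many intervals
`[x, u] = u [u⁻¹ x, O_r(u)]`, with `u` maximal. -/
theorem DivLeftIdeal.finite_Icc {x : DivLeftIdeal A} (hx : x ≤ unit A) :
    (Set.Icc x (unit A)).Finite := by
  induction hn : Multiset.card (factors x (unit A)) generalizing A with
  | zero =>
    have := eq_of_chainLabels_eq_zero hx (Multiset.card_eq_zero.1 hn)
    rw [this, Set.Icc_self]
    exact Set.finite_singleton _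
  | succ n ih =>
    obtain ⟨B, v, rfl⟩ := x.exists_hom
    obtain ⟨X, hX⟩ := NormGroup.exists_subset v
    have hcov := (finite_covBy hfin ((NormGroup.le_one_iff A).2 (hX.trans hx)) A).subset
      (fun y (hy : y ⋖ unit A ∧ ofHom v ≤ y) =>
        (⟨hy.1, le_trans (show ofHom (X.1 A) ≤ ofHom v from hX) hy.2⟩ :
          y ⋖ unit A ∧ ofHom (X.1 A) ≤ y))
    refine ((Set.finite_singleton (unit A)).union (hcov.biUnion (t := fun y => Set.Icc (ofHom v) y)
      ?_)).subset ?_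
    · rintro y ⟨hy, hvy⟩
      obtain ⟨C, u, rfl⟩ := y.exists_hom
      have e : ofHom v = smul u (ofHom (Groupoid.inv u ≫ v)) := by simp
      have hle : ofHom (Groupoid.inv u ≫ v) ≤ unit C := by
        rwa [← (smul u).le_iff_le, ← e, smul_unit]
      have hcard : Multiset.card (factors (ofHom (Groupoid.inv u ≫ v)) (unit C)) = n := by
        rw [← factors_smul u hle, ← e, smul_unit]
        rw [← factors_add hvy hy.le, Multiset.card_add, factors_covBy hy,
          Multiset.card_singleton] at hn
        omega
      have := (ih hle hcard).image (smul u)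
      rwa [OrderIso.image_Icc, ← e, smul_unit] at this
    · rintro y ⟨hvy, hy⟩
      rcases hy.eq_or_lt with rfl | hlt
      · exact Or.inl rfl
      · right
        obtain ⟨t, hyt, ht⟩ := exists_le_covBy hlt
        exact Set.mem_biUnion (x := t) ⟨ht, hvy.trans hyt⟩ ⟨hvy, hyt⟩

end FiniteIntervals

/-! ### Factorizations in monoids with a length function -/

section Lengths

variable {M : Type*} [Monoid M] {len : M → ℕ} (hmul : ∀ a b, len (a * b) = len a + len b)
  (hunit : ∀ a, len a = 0 ↔ IsUnit a)
include hmul hunit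

theorem exists_atoms_of_not_isUnit {a : M} (ha : ¬ IsUnit a) :
    ∃ l : List M, (∀ u ∈ l, Irreducible u) ∧ l.prod = a := by
  induction hn : len a using Nat.strong_induction_on generalizing a with
  | _ n ih =>
    by_cases hirr : Irreducible a
    · exact ⟨[a], by simpa using hirr, by simp⟩
    · rw [irreducible_iff] at hirr
      push Not at hirr
      obtain ⟨b, c, rfl, hb, hc⟩ := hirr ha
      have hb' : len b ≠ 0 := fun h => hb ((hunit b).1 h)
      have hc' : len c ≠ 0 := fun h => hc ((hunit c).1 h)
      have hbc := hmul b c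
      obtain ⟨l, hl, rfl⟩ := ih _ (by omega) hb rfl
      obtain ⟨l', hl', rfl⟩ := ih _ (by omega) hc rfl
      exact ⟨l ++ l', by simpa [or_imp, forall_and] using ⟨hl, hl'⟩, by simp⟩

theorem exists_rigidWord (a : M) : ∃ w : RigidWord M, w.value = a := by
  by_cases ha : IsUnit a
  · obtain ⟨ε, rfl⟩ := ha
    exact ⟨⟨ε, [], by simp⟩, by simp [RigidWord.value]⟩
  · obtain ⟨l, hl, rfl⟩ := exists_atoms_of_not_isUnit hmul hunit ha
    exact ⟨⟨1, l, hl⟩, by simp [RigidWord.value]⟩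

theorem RigidWord.length_le (w : RigidWord M) : w.atoms.length ≤ len w.value := by
  have h : ∀ l : List M, (∀ u ∈ l, Irreducible u) → l.length ≤ len l.prod := by
    intro l
    induction l with
    | nil => simp
    | cons u l ih =>
      intro hl
      rw [List.prod_cons, hmul, List.length_cons]
      have h1 := ih fun v hv => hl v (List.mem_cons_of_mem _ hv)
      have h2 : len u ≠ 0 := fun h => (hl u List.mem_cons_self).not_isUnit ((hunit u).1 h)
      omega
  rw [RigidWord.value, hmul]
  exact (h _ w.irreducible).trans (Nat.le_add_left _ _)

theorem lengthSet_finite_nonempty (a : M) : (lengthSet a).Finite ∧ (lengthSet a).Nonempty := by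
  constructor
  · refine (Set.finite_Iic (len a)).subset ?_
    rintro _ ⟨z, rfl, rfl⟩
    induction z using Quotient.ind with
    | _ w => exact w.length_le hmul hunit
  · obtain ⟨w, hw⟩ := exists_rigidWord hmul hunit a
    exact ⟨_, Quotient.mk _ w, hw, rfl⟩

omit hmul hunit in
theorem RigidWord.rel_of_associated [IsRightCancelMul M] {w w' : RigidWord M}
    (hv : w.value = w'.value) (hl : w.atoms.length = w'.atoms.length)
    (h : ∀ i ≤ w.atoms.length, ∃ δ : Mˣ, (w'.atoms.drop i).prod = δ * (w.atoms.drop i).prod) :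
    w.Rel w' := by
  have h' : ∀ i, ∃ δ : Mˣ, i ≤ w.atoms.length →
      (w'.atoms.drop i).prod = δ * (w.atoms.drop i).prod := by
    intro i
    by_cases hi : i ≤ w.atoms.length
    · obtain ⟨δ, hδ⟩ := h i hi
      exact ⟨δ, fun _ => hδ⟩
    · exact ⟨1, fun h => absurd h hi⟩
  choose δ hδ using h'
  refine ⟨hv, hl, δ, ?_, ?_, fun i hi => ?_⟩
  · have h0 := hδ 0 (Nat.zero_le _)
    rw [List.drop_zero, List.drop_zero] at h0
    rw [RigidWord.value, RigidWord.value, h0, ← mul_assoc] at hv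
    have := mul_right_cancel hv
    rw [← Units.val_mul, Units.val_inj] at this
    rw [this, inv_mul_cancel_left]
  · have h0 := hδ _ le_rfl
    rw [List.drop_length, hl, List.drop_length, List.prod_nil, mul_one, ← hl] at h0
    exact (Units.val_eq_one.1 h0.symm)
  · have h0 := hδ i hi.le
    have h1 := hδ (i + 1) hi
    rw [List.drop_eq_getElem_cons hi, List.drop_eq_getElem_cons (hl ▸ hi), List.prod_cons,
      List.prod_cons, h1, ← mul_assoc, ← mul_assoc] at h0
    rw [← mul_right_cancel h0, Units.mul_inv_cancel_right]

/-- If `φ` separates the elements of `M` up to associates, then a rigid factorization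
`ε u₁ ⋯ u_k` is determined by the sequence of all `φ (u_i ⋯ u_k)`. -/
theorem rigidFactorizations_finite [IsRightCancelMul M] {T : Type*} (φ : M → T)
    (hφ : ∀ x y, φ x = φ y → ∃ δ : Mˣ, y = δ * x) (a : M)
    (hfin : {t | ∃ x y, a = x * y ∧ φ y = t}.Finite) : (rigidFactorizations a).Finite := by
  obtain ⟨rep, hrep⟩ : ∃ rep : RigidFactorization M → RigidWord M,
      ∀ z, (Quotient.mk (RigidWord.setoid M) (rep z) : RigidFactorization M) = z :=
    ⟨Quotient.out, Quotient.out_eq⟩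
  let f : RigidFactorization M → ℕ × (Fin (len a + 1) → T) := fun z =>
    ((rep z).atoms.length, fun i => φ ((rep z).atoms.drop i).prod)
  have hval : ∀ z ∈ rigidFactorizations a, (rep z).value = a := by
    intro z hz
    rw [← hrep z] at hz
    exact hz
  refine Set.Finite.of_finite_image (f := f) (((Set.finite_Iic (len a)).prod
    (Set.Finite.pi' fun _ => hfin)).subset ?_) ?_
  · rintro _ ⟨z, hz, rfl⟩
    have hv := hval z hz
    refine ⟨?_, fun i => ?_⟩
    · have := (rep z).length_le hmul hunit
      rwa [hv] at this
    · refine ⟨(rep z).unit * ((rep z).atoms.take i).prod, _, ?_, rfl⟩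
      rw [mul_assoc, List.prod_take_mul_prod_drop]
      exact hv.symm
  · intro z hz z' hz' h
    have hv := hval z hz
    have hlen := (rep z).length_le hmul hunit
    rw [hv] at hlen
    rw [← hrep z, ← hrep z']
    refine Quotient.sound (RigidWord.rel_of_associated (hv.trans (hval z' hz').symm)
      (congrArg Prod.fst h) fun i hi => ?_)
    exact hφ _ _ (congrFun (congrArg Prod.snd h) ⟨i, by omega⟩)

end Lengths

/-! ### The cancellative elements of an order -/

section CancellativeElements

variable {Q : Type*} [Monoid Q] {H : Submonoid Q}

theorem IsOrder.isRegular_coe (hH : IsOrder H) {a : H} (ha : IsRegular a) :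
    IsRegular (a : Q) := by
  constructor
  · intro x y hxy
    -- `x` and `y` have a common right denominator
    obtain ⟨c, hc, s, hs, rfl⟩ := hH.right x
    obtain ⟨d, hd, t, ht, rfl⟩ := hH.right y
    obtain ⟨f, hf, g, hg, e⟩ := hH.right ((s⁻¹ * t : Qˣ) : Q)
    have e' : (t : Q) * g = s * f := by
      have := congrArg (fun z => (s : Q) * z * g) e
      simpa [mul_assoc] using this
    have hx : c * ((s⁻¹ : Qˣ) : Q) * (t * g) = c * f := by rw [e']; simp [mul_assoc]
    have hy : d * ((t⁻¹ : Qˣ) : Q) * (t * g) = d * g := by simp [mul_assoc]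
    have hcan := congrArg (fun z => z * ((t : Q) * g)) hxy
    simp only [mul_assoc (a : Q)] at hcan
    rw [hx, hy] at hcan
    have := @ha.left ⟨c * f, H.mul_mem hc hf⟩ ⟨d * g, H.mul_mem hd hg⟩ (Subtype.ext hcan)
    have h2 : c * f = d * g := congrArg Subtype.val this
    rw [← hx, ← hy, ← Units.val_mul, Units.mul_left_inj] at h2
    exact h2
  · intro x y hxy
    obtain ⟨c, hc, s, hs, rfl⟩ := hH.left x
    obtain ⟨d, hd, t, ht, rfl⟩ := hH.left y
    obtain ⟨f, hf, g, hg, e⟩ := hH.left ((t * s⁻¹ : Qˣ) : Q)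
    have e' : (g : Q) * t = f * s := by
      have := congrArg (fun z => (g : Q) * z * s) e
      simpa [mul_assoc] using this
    have hx : ((g : Q) * t) * (((s⁻¹ : Qˣ) : Q) * c) = f * c := by rw [e']; simp [mul_assoc]
    have hy : ((g : Q) * t) * (((t⁻¹ : Qˣ) : Q) * d) = g * d := by simp [mul_assoc]
    have hcan := congrArg (fun z => ((g : Q) * t) * z) hxy
    simp only [← mul_assoc _ _ (a : Q)] at hcan
    rw [hx, hy] at hcan
    have := @ha.right ⟨f * c, H.mul_mem hf hc⟩ ⟨g * d, H.mul_mem hg hd⟩ (Subtype.ext hcan)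
    have h2 : f * c = g * d := congrArg Subtype.val this
    rw [← hx, ← hy, ← Units.val_mul, Units.mul_right_inj] at h2
    exact h2

instance : IsRightCancelMul (cancellativeElements H) :=
  ⟨fun c _ _ h => Subtype.ext (c.2.right (congrArg Subtype.val h))⟩

/-- The embedding of `H^•` into `Q^•`. -/
noncomputable def unitOf (hQ : IsQuotientSemigroup Q) (hH : IsOrder H) :
    cancellativeElements H →* Qˣ :=
  IsUnit.liftRight (H.subtype.comp (cancellativeElements H).subtype)
    fun a => hQ _ (hH.isRegular_coe a.2)

variable (hQ : IsQuotientSemigroup Q) (hH : IsOrder H)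

theorem unitOf_injective : Function.Injective (unitOf hQ hH) := fun _ _ h =>
  Subtype.ext (Subtype.ext (congrArg Units.val h))

theorem exists_unitOf_eq {q : Qˣ} (hq : (q : Q) ∈ H) :
    ∃ a : cancellativeElements H, unitOf hQ hH a = q := by
  refine ⟨⟨⟨q, hq⟩, ?_, ?_⟩, Units.ext rfl⟩
  · intro x y h
    exact Subtype.ext (q.isUnit.isRegular.left (congrArg Subtype.val h))
  · intro x y h
    exact Subtype.ext (q.isUnit.isRegular.right (congrArg Subtype.val h))

end CancellativeElements

/-! ### Principal ideals and the transfer homomorphism -/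

section Principal

variable {Q : Type*} [Monoid Q] {H : Submonoid Q} [hH : Fact (IsArithmeticalMaximalOrder H)]

open DivLeftIdeal

variable (H) in
/-- The order `H` as an element of `α`. -/
abbrev baseOrder : MaximalOrderClass H := MaximalOrderClass.base hH.out.isMaximalOrder

variable (H) in
/-- The homomorphism `q ↦ η(Hq)`. Its multiplicativity comes from the invariance of relative norms
under multiplication from the right by `Q^•`. -/
noncomputable def principalNorm : Qˣ →* NormGroup H :=
  MonoidHom.mk' (fun q => relNorm factorNorm (rmul (baseOrder H) q (unit _)) (unit _)) <| by
    intro q r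
    have h := relNorm_map factorNorm_sup (rmul (baseOrder H) r) (factorNorm_rmul r)
      (x := rmul (baseOrder H) q (unit _)) (y := unit _)
    rw [rmul_rmul] at h
    rw [← h, relNorm_mul factorNorm_sup]

theorem principalNorms_eq_range :
    principalNorms hH.out.isMaximalOrder (fun _ _ u => abstractNorm u) =
      ((principalNorm H).range : Set (NormGroup H)) := by
  ext X
  constructor
  · rintro ⟨q, B, I, hI, rfl⟩
    refine ⟨q, ?_⟩
    have : ofHom I = rmul (baseOrder H) q (unit _) := by
      apply SetLike.coe_injective
      rw [coe_rmul_unit, coe_ofHom, hI]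
      rfl
    change _ = abstractNorm I
    rw [abstractNorm, this]
    rfl
  · rintro ⟨q, rfl⟩
    obtain ⟨B, I, hI⟩ := (rmul (baseOrder H) q (unit _)).exists_hom
    refine ⟨q, B, I, ?_, ?_⟩
    · rw [← coe_ofHom, hI, coe_rmul_unit]
      rfl
    · change abstractNorm I = _
      rw [abstractNorm, hI]
      rfl

variable (hQ : IsQuotientSemigroup Q)

/-- The unit of `Q` given by a cancellative element of `H`. -/
noncomputable abbrev quot : cancellativeElements H →* Qˣ := unitOf hQ hH.out.isMaximalOrder.1

/-- The principal ideal `Ha`. -/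
noncomputable def principal (a : cancellativeElements H) : DivLeftIdeal (baseOrder H) :=
  rmul (baseOrder H) (quot hQ a) (unit _)

theorem mem_principal {a : cancellativeElements H} {p : Q} :
    p ∈ principal hQ a ↔ p * (((quot hQ a)⁻¹ : Qˣ) : Q) ∈ H := Iff.rfl

theorem principal_mul (a b : cancellativeElements H) :
    principal hQ (a * b) = rmul (baseOrder H) (quot hQ b) (principal hQ a) := by
  rw [principal, principal, rmul_rmul, map_mul]

theorem principal_one : principal hQ (1 : cancellativeElements H) = unit (baseOrder H) := by
  rw [principal, map_one, rmul_one]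

theorem principal_le_principal_iff {a b : cancellativeElements H} :
    principal hQ a ≤ principal hQ b ↔ ∃ c, a = c * b := by
  constructor
  · intro h
    have hmem : (quot hQ a : Q) ∈ principal hQ b := h (by
      rw [SetLike.mem_coe, mem_principal, Units.mul_inv]
      exact H.one_mem)
    rw [mem_principal, ← Units.val_mul] at hmem
    obtain ⟨c, hc⟩ := exists_unitOf_eq hQ hH.out.isMaximalOrder.1 hmem
    refine ⟨c, unitOf_injective hQ hH.out.isMaximalOrder.1 ?_⟩
    rw [map_mul, hc, inv_mul_cancel_right]
  · rintro ⟨c, rfl⟩ p hp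
    rw [SetLike.mem_coe, mem_principal] at hp ⊢
    have hc : ((quot hQ c : Qˣ) : Q) ∈ H := c.1.2
    have := H.mul_mem hp hc
    rw [map_mul, mul_inv_rev] at this
    simpa [mul_assoc] using this

theorem principal_le_unit (a : cancellativeElements H) :
    principal hQ a ≤ unit (baseOrder H) := by
  rw [← principal_one hQ]
  exact (principal_le_principal_iff hQ).2 ⟨a, (mul_one a).symm⟩

theorem exists_unit_mul_of_principal_eq {a b : cancellativeElements H}
    (h : principal hQ a = principal hQ b) : ∃ δ : (cancellativeElements H)ˣ, b = δ * a := by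
  obtain ⟨c, hc⟩ := (principal_le_principal_iff hQ).1 h.le
  obtain ⟨d, hd⟩ := (principal_le_principal_iff hQ).1 h.ge
  have hcd : c * d = 1 := by
    apply mul_right_cancel (b := a)
    rw [mul_assoc, ← hd, ← hc, one_mul]
  have hdc : d * c = 1 := by
    apply mul_right_cancel (b := b)
    rw [mul_assoc, ← hc, ← hd, one_mul]
  exact ⟨⟨d, c, hdc, hcd⟩, hd⟩

theorem principal_eq_unit_iff {a : cancellativeElements H} :
    principal hQ a = unit (baseOrder H) ↔ IsUnit a := by
  constructor
  · intro h
    rw [← principal_one hQ] at h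
    obtain ⟨δ, hδ⟩ := exists_unit_mul_of_principal_eq hQ h.symm
    rw [hδ, mul_one]
    exact δ.isUnit
  · rintro ⟨ε, rfl⟩
    refine le_antisymm (principal_le_unit hQ _) ?_
    rw [← principal_one hQ]
    exact (principal_le_principal_iff hQ).2 ⟨(ε⁻¹ : (cancellativeElements H)ˣ), by simp⟩

/-- The norms of the composition factors between `Ha` and `H`. -/
noncomputable def factorsOf (a : cancellativeElements H) : Multiset (NormGroup H) :=
  factors (principal hQ a) (unit (baseOrder H))

theorem factors_principal_mul (a b : cancellativeElements H) :
    factors (principal hQ (a * b)) (principal hQ b) = factorsOf hQ a := by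
  rw [principal_mul]
  exact factors_rmul _ (principal_le_unit hQ a)

theorem factorsOf_mul (a b : cancellativeElements H) :
    factorsOf hQ (a * b) = factorsOf hQ a + factorsOf hQ b := by
  rw [← factors_principal_mul hQ a b, factorsOf, factorsOf]
  exact (factors_add ((principal_le_principal_iff hQ).2 ⟨a, rfl⟩) (principal_le_unit hQ b)).symm

theorem factorsOf_eq_zero_iff {a : cancellativeElements H} : factorsOf hQ a = 0 ↔ IsUnit a := by
  rw [← principal_eq_unit_iff hQ]
  constructor
  · exact eq_of_chainLabels_eq_zero (principal_le_unit hQ a)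
  · intro h
    rw [factorsOf, h, factors, chainLabels_self]

theorem prod_factorsOf (a : cancellativeElements H) :
    (factorsOf hQ a).prod = principalNorm H (quot hQ a) :=
  (relNorm_of_le factorNorm_sup (principal_le_unit hQ a)).symm

include hQ in
theorem lengthSet_cancellativeElements (a : cancellativeElements H) :
    (lengthSet a).Finite ∧ (lengthSet a).Nonempty :=
  lengthSet_finite_nonempty (len := fun a => Multiset.card (factorsOf hQ a))
    (fun a b => by rw [factorsOf_mul, Multiset.card_add])
    (fun a => by rw [Multiset.card_eq_zero, factorsOf_eq_zero_iff]) a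

include hQ in
theorem rigidFactorizations_cancellativeElements
    (hfin : ∀ (A : MaximalOrderClass H) (P : Set Q), IsMaximalDivisorialIdeal A.order P →
      {I : Set Q | IsMaximalDivisorialLeftIdeal A.order I ∧ P ⊆ I}.Finite)
    (a : cancellativeElements H) : (rigidFactorizations a).Finite := by
  refine rigidFactorizations_finite (len := fun a => Multiset.card (factorsOf hQ a))
    (fun a b => by rw [factorsOf_mul, Multiset.card_add])
    (fun a => by rw [Multiset.card_eq_zero, factorsOf_eq_zero_iff])
    (principal hQ) (fun _ _ => exists_unit_mul_of_principal_eq hQ) a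
    ((finite_Icc hfin (principal_le_unit hQ a)).subset ?_)
  rintro _ ⟨x, y, rfl, rfl⟩
  exact ⟨(principal_le_principal_iff hQ).2 ⟨x, rfl⟩, principal_le_unit hQ y⟩

end Principal

section Transfer

variable {Q : Type*} [Monoid Q] {H : Submonoid Q} [hH : Fact (IsArithmeticalMaximalOrder H)]

open DivLeftIdeal

variable (H) in
/-- The class group `C` for the abstract norm. -/
abbrev NormClasses : Type _ :=
  NormClassGroup (H := H) hH.out.isMaximalOrder fun _ _ u => abstractNorm u

variable (H) in
/-- The set `C_M` for the abstract norm. -/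
abbrev maxClasses : Set (NormClasses H) :=
  maximalClasses (H := H) hH.out.isMaximalOrder fun _ _ u => abstractNorm u

variable (H) in
/-- The projection of `𝔾` onto `C`. -/
def toClass : NormGroup H →* NormClasses H := QuotientGroup.mk' _

theorem toClass_eq_one_iff {X : NormGroup H} :
    toClass H X = 1 ↔ ∃ q, principalNorm H q = X := by
  rw [toClass, QuotientGroup.mk'_apply, QuotientGroup.eq_one_iff, principalNorms_eq_range,
    Subgroup.closure_eq]
  rfl

theorem toClass_mem_maxClasses {A : MaximalOrderClass H} {x y : DivLeftIdeal A} (h : x ≤ y) :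
    ∀ g ∈ (factors x y).map (toClass H), g ∈ maxClasses H := by
  intro g hg
  obtain ⟨X, hX, rfl⟩ := Multiset.mem_map.1 hg
  obtain ⟨B, C, u, hu, rfl⟩ := exists_hom_of_mem_factors h hX
  exact ⟨B, C, u, hu, rfl⟩

/-- If every class of `C_M` is represented over every order, then so is every sequence over
`C_M`. -/
theorem exists_map_factors_eq
    (hclass : ∀ (A : MaximalOrderClass H), ∀ g ∈ maxClasses H,
      ∃ (B : MaximalOrderClass H) (I : A ⟶ B),
        IsMaximalDivisorialLeftIdeal A.order (idealSet I) ∧ toClass H (abstractNorm I) = g)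
    (S : Multiset (NormClasses H)) (hS : ∀ g ∈ S, g ∈ maxClasses H)
    (A : MaximalOrderClass H) :
    ∃ x : DivLeftIdeal A, x ≤ unit A ∧ (factors x (unit A)).map (toClass H) = S := by
  induction S using Multiset.induction generalizing A with
  | empty => exact ⟨unit A, le_rfl, by rw [factors, chainLabels_self, Multiset.map_zero]⟩
  | cons g S ih =>
    obtain ⟨B, u, hu, hg⟩ := hclass A g (hS g (Multiset.mem_cons_self g S))
    obtain ⟨x, hx, hxS⟩ := ih (fun g' hg' => hS g' (Multiset.mem_cons_of_mem hg')) B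
    have hu' : ofHom u ⋖ unit A := isMaximal_iff_covBy.1 hu
    have hle : smul u x ≤ ofHom u := by
      rw [← smul_unit]
      exact (smul u).monotone hx
    refine ⟨smul u x, hle.trans hu'.le, ?_⟩
    rw [← factors_add hle hu'.le, Multiset.map_add, factors_covBy hu', ← abstractNorm_of_covBy hu',
      Multiset.map_singleton, hg, ← smul_unit, factors_smul u hx, hxS, add_comm,
      Multiset.singleton_add]

/-- The map sending `a` to the classes of the composition factors of `[Ha, H]` is a transfer
homomorphism. -/
theorem exists_transferHom (hQ : IsQuotientSemigroup Q)
    (hprincipal : ∀ (B : MaximalOrderClass H) (I : baseOrder H ⟶ B),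
      (∃ q, principalNorm H q = abstractNorm I) → ∃ q : Qˣ, idealSet I = (H : Set Q) * {(q : Q)})
    (hclass : ∀ (A : MaximalOrderClass H), ∀ g ∈ maxClasses H,
      ∃ (B : MaximalOrderClass H) (I : A ⟶ B),
        IsMaximalDivisorialLeftIdeal A.order (idealSet I) ∧ toClass H (abstractNorm I) = g) :
    ∃ θ : cancellativeElements H →* zeroSumSequences (maxClasses H), IsTransferHom θ := by
  have hlift : ∀ a : cancellativeElements H, ∃ T : Multiset (maxClasses H),
      T.map Subtype.val = (factorsOf hQ a).map (toClass H) := by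
    intro a
    lift (factorsOf hQ a).map (toClass H) to Multiset (maxClasses H) using
      toClass_mem_maxClasses (principal_le_unit hQ a) with T hT
    exact ⟨T, rfl⟩
  choose T hT using hlift
  have hinj := Multiset.map_injective (Subtype.val_injective (p := fun g => g ∈ maxClasses H))
  have hmul : ∀ a b, T (a * b) = T a + T b := by
    intro a b
    apply hinj
    rw [hT, factorsOf_mul, Multiset.map_add, Multiset.map_add, hT, hT]
  have hzero : ∀ a, T a = 0 ↔ IsUnit a := by
    intro a
    rw [← factorsOf_eq_zero_iff hQ, ← Multiset.map_eq_zero (f := toClass H), ← hT,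
      Multiset.map_eq_zero]
  have hsum : ∀ a, ((T a).map Subtype.val).prod = 1 := by
    intro a
    rw [hT, Multiset.prod_hom, prod_factorsOf]
    exact toClass_eq_one_iff.2 ⟨_, rfl⟩
  -- an integral left ideal of trivial class is generated by an element of `H^•`
  have hgen : ∀ x : DivLeftIdeal (baseOrder H), x ≤ unit _ →
      ((factors x (unit _)).map (toClass H)).prod = 1 → ∃ a, principal hQ a = x := by
    intro x hx hprod
    rw [Multiset.prod_hom] at hprod
    obtain ⟨B, I, rfl⟩ := x.exists_hom
    rw [← abstractNorm_of_integral hx] at hprod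
    obtain ⟨q, hq⟩ := hprincipal B I (toClass_eq_one_iff.1 hprod)
    have hqI : ofHom I = rmul (baseOrder H) q (unit _) := by
      apply SetLike.coe_injective
      rw [coe_rmul_unit, coe_ofHom, hq]
      rfl
    have hqH : (q : Q) ∈ H := by
      apply hx
      rw [hqI, SetLike.mem_coe, mem_rmul, Units.mul_inv]
      exact H.one_mem
    obtain ⟨a, rfl⟩ := exists_unitOf_eq hQ hH.out.isMaximalOrder.1 hqH
    exact ⟨a, hqI.symm⟩
  let θ : cancellativeElements H →* zeroSumSequences (maxClasses H) :=
    { toFun := fun a => ⟨Multiplicative.ofAdd (T a), hsum a⟩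
      map_one' := Subtype.ext (congrArg Multiplicative.ofAdd ((hzero 1).2 isUnit_one))
      map_mul' := fun a b => Subtype.ext (congrArg Multiplicative.ofAdd (hmul a b)) }
  have hθ : ∀ a b, θ a = b ↔ T a = Multiplicative.toAdd b.1 := fun a b =>
    ⟨fun h => congrArg (fun t => Multiplicative.toAdd t.1) h,
      fun h => Subtype.ext (congrArg Multiplicative.ofAdd h)⟩
  refine ⟨θ, ?_, ?_, ?_⟩
  · rintro ⟨S, hS⟩
    obtain ⟨x, hx, hxS⟩ := exists_map_factors_eq hclass
      ((Multiplicative.toAdd S).map Subtype.val) (fun g hg => by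
        obtain ⟨s, -, rfl⟩ := Multiset.mem_map.1 hg
        exact s.2) (baseOrder H)
    obtain ⟨a, rfl⟩ := hgen x hx (by rw [hxS]; exact hS)
    refine ⟨a, (hθ _ _).2 (hinj ?_)⟩
    rw [hT]
    exact hxS
  · intro a
    rw [← hzero]
    exact hθ a 1
  · rintro a ⟨S₁, h₁⟩ ⟨S₂, h₂⟩ hab
    have h := congrArg (Multiset.map Subtype.val) ((hθ _ _).1 hab)
    rw [hT] at h
    change _ = Multiset.map Subtype.val (Multiplicative.toAdd S₁ + Multiplicative.toAdd S₂) at h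
    rw [Multiset.map_add] at h
    obtain ⟨y, hay, hy, e1, e2⟩ :=
      exists_between_of_map_factors_eq_add (toClass H) (principal_le_unit hQ a) h
    obtain ⟨a₂, rfl⟩ := hgen y hy (by rw [e2]; exact h₂)
    obtain ⟨a₁, rfl⟩ := (principal_le_principal_iff hQ).1 hay
    rw [factors_principal_mul] at e1
    exact ⟨a₁, a₂, rfl, (hθ _ _).2 (hinj (by rw [hT]; exact e1)),
      (hθ _ _).2 (hinj (by rw [hT]; exact e2))⟩

end Transfer

theorem mainTheorem3 {Q : Type*} [Monoid Q] (hQ : IsQuotientSemigroup Q)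
    (H : Submonoid Q) (hH : IsArithmeticalMaximalOrder H) :
    -- sets of lengths
    (∀ a : cancellativeElements H, (lengthSet a).Finite ∧ (lengthSet a).Nonempty) ∧
    -- rigid factorizations (finiteness is assumed over every maximal order equivalent to `H`)
    ((∀ (A : MaximalOrderClass H) (P : Set Q), IsMaximalDivisorialIdeal A.order P →
        {I : Set Q | IsMaximalDivisorialLeftIdeal A.order I ∧ P ⊆ I}.Finite) →
      ∀ a : cancellativeElements H, (rigidFactorizations a).Finite) ∧
    -- the abstract norm is well defined
    (∃! η : ∀ A B : MaximalOrderClass H, (A ⟶ B) → universalVertexGroup (MaximalOrderClass H),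
      IsAbstractNorm η) ∧
    -- the transfer homomorphism
    ∀ η : ∀ A B : MaximalOrderClass H, (A ⟶ B) → universalVertexGroup (MaximalOrderClass H),
      IsAbstractNorm η →
      (∀ (B : MaximalOrderClass H) (I : MaximalOrderClass.base hH.isMaximalOrder ⟶ B),
        (∃ q : Qˣ, idealSet I = (H : Set Q) * {(q : Q)}) ↔
          η _ B I ∈ principalNorms hH.isMaximalOrder η) →
      (∀ (A : MaximalOrderClass H), ∀ g ∈ maximalClasses hH.isMaximalOrder η,
        ∃ (B : MaximalOrderClass H) (I : A ⟶ B),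
          IsMaximalDivisorialLeftIdeal A.order (idealSet I) ∧
            normClass hH.isMaximalOrder η I = g) →
      ∃ θ : cancellativeElements H →* zeroSumSequences (maximalClasses hH.isMaximalOrder η),
        IsTransferHom θ := by
  have : Fact (IsArithmeticalMaximalOrder H) := ⟨hH⟩
  refine ⟨lengthSet_cancellativeElements hQ, rigidFactorizations_cancellativeElements hQ,
    ⟨_, isAbstractNorm_abstractNorm, fun η hη => hη.eq_abstractNorm⟩, ?_⟩
  intro η hη hprincipal hclass
  obtain rfl := hη.eq_abstractNorm
  refine exists_transferHom hQ (fun B I hI => (hprincipal B I).2 ?_) hclass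
  rw [principalNorms_eq_range]
  exact hI
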